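/- **Notation.** For an integer $n$ let $[n]=\{1,\dots,n\}$. Let $a,b$ be positive integers, let $l$ be a nonnegative integer, and let $\alpha=\{\alpha_1<\dots<\alpha_r\}\subset[a]$ and $\beta=\{\beta_1<\dots<\beta_r\}\subset[b]$ have the same number $r$ of elements. Regard $[a]\times[b]$ as a rectangle of lattice points $(i,j)$ with row $i$ (rows numbered downwards) and column $j$. *Osculating paths.* $\mathrm{OP}(a,b,\alpha,\beta)$ is the set of $r$-tuples $P=(P_1,\dots,P_r)$ in which $P_k$ is a lattice path from $(a,\beta_k)$ to $(\alpha_k,b)$ with steps $(0,1)$ and $(-1,0)$, and consecutive paths are osculating: whenever $P_k$ and $P_{k+1}$ share a point $(i,j)$, $P_k$ passes through $(i,j-1),(i,j),(i-1,j)$ in succession, while the point of $P_{k+1}$ just before $(i,j)$ is $(i+1,j)$ (unless $P_{k+1}$ starts at $(i,j)$) and the one just after is $(i,j+1)$ (unless $P_{k+1}$ ends at $(i,j)$). $Z(P)$ is the set of points of $[a]\times[b]$ which lie on no path of $P$ or on two paths of $P$, and $$\mathrm{VOS}(a,b,\alpha,\beta,l)=\{Z(P)\mid P\in\mathrm{OP}(a,b,\alpha,\beta),\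 |Z(P)|=l\}.$$ *Partitions.* The content of a point or square in row $i$ and column $j$ is $j-i$. Two partitions differ by a square if one of their Young diagrams is obtained from the other by adding one square; the content of that square is their diagonal difference. $\lambda_{a,b,\alpha,\beta}$ is the partition with at most $a$ parts, each at most $b$, defined as the complement $(b-\mu_a,\dots,b-\mu_1)$ of the partition $\mu$ with Frobenius notation $(b-\beta_1,\dots,b-\beta_r\mid a-\alpha_1,\dots,a-\alpha_r)$. *Generalized oscillating tableaux.* $\mathrm{OT}(\lambda,l)$ is the set of sequences $\eta=(\eta_0,\dots,\eta_l)$ of partitions with $\eta_0=\emptyset$ and $\eta_l=\lambda$, successive partitions differing by a square. The profile of $\eta$ is $\Omega(\eta)=(\Omega(\eta)_1,\dots,\Omega(\eta)_l)$, where $\Omega(\eta)_k$ is the diagonal difference of $\eta_{k-1}$ and $\eta_k$; it determines $\eta$. For a set $T$ of positive integers and a total strict order $\prec$ on $\mathbb Z$, $\mathrm{GOT}(T,\prec,\lambda,l)$ is the set of pairs $(t,\eta)\in T^l\times\mathrm{OT}(\lambda,l)$ such that, for each $k\in[l-1]$, either $t_k<t_{k+1}$, or $t_k=t_{k+1}$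 and $\Omega(\eta)_k\prec\Omega(\eta)_{k+1}$. *Induced mappings.* An ordering pair $(L,\prec)$ consists of a function $L$ from pairs of positive integers to positive integers and a total strict order $\prec$ on $\mathbb Z$ such that $L(i,j)<L(i',j')$, or $L(i,j)=L(i',j')$ and $j-i\prec j'-i'$, implies $i<i'$ or $j<j'$. For $S\in\mathrm{VOS}(a,b,\alpha,\beta,l)$, let $s_1,\dots,s_l$ be the elements of $S$, ordered so that for each $k\in[l-1]$ either $L(s_k)<L(s_{k+1})$, or $L(s_k)=L(s_{k+1})$ and the content of $s_k$ precedes that of $s_{k+1}$ in $\prec$. The mapping induced by $(L,\prec)$ is $$\Theta_{(L,\prec)}(S)=\bigl((L(s_1),\dots,L(s_l)),\eta\bigr),$$ where $\eta$ is the oscillating tableau whose profile is the sequence of the contents of $s_1,\dots,s_l$. The lexicographic ordering pair is $(\hat L,<)$ with $\hat L(i,j)=i$, and the antilexicographic ordering pair is $(\check L,>)$ with $\check L(i,j)=j$. **Theorem.** (1) If $\alpha=[a]$, then $\Theta_{(\hat L,<)}$ is well defined on $\mathrm{VOS}(a,b,[a],\beta,l)$ and is a bijection from it to $\mathrm{GOT}([a],<,\lambda_{a,b,[a],\beta},l)$,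 with inverse mapping $$(t,\eta)\mapsto\{(t_1,t_1+\Omega(\eta)_1),\dots,(t_l,t_l+\Omega(\eta)_l)\}.$$ (2) If $\beta=[b]$, then $\Theta_{(\check L,>)}$ is well defined on $\mathrm{VOS}(a,b,\alpha,[b],l)$ and is a bijection from it to $\mathrm{GOT}([b],>,\lambda_{a,b,\alpha,[b]},l)$, with inverse mapping $$(t,\eta)\mapsto\{(t_1-\Omega(\eta)_1,t_1),\dots,(t_l-\Omega(\eta)_l,t_l)\}.$$ -/

import Mathlib

/-! ### Osculating paths in the `a` by `b` rectangle

Lattice points are pairs `(i, j) : ℤ × ℤ`, `i` being the row (rows go down) and `j` the column.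
The set `[n] = {1, …, n}` is `Finset.Icc 1 n`. -/

/-- A pair of boundary point sets `(α, β)` with `α ⊆ [a]`, `β ⊆ [b]` and `|α| = |β|`. -/
structure BoundaryPair (a b : ℕ) where
  α : Finset ℤ
  β : Finset ℤ
  α_subset : α ⊆ Finset.Icc 1 (a : ℤ)
  β_subset : β ⊆ Finset.Icc 1 (b : ℤ)
  card_eq : α.card = β.card

namespace BoundaryPair

variable {a b : ℕ}

/-- The common number `r` of elements of `α` and `β`. -/
def r (B : BoundaryPair a b) : ℕ := B.α.card

/-- `α₁ < … < α_r`. -/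
def αSeq (B : BoundaryPair a b) : Fin B.r → ℤ := fun k => B.α.orderEmbOfFin rfl k

/-- `β₁ < … < β_r`. -/
def βSeq (B : BoundaryPair a b) : Fin B.r → ℤ := fun k => B.β.orderEmbOfFin B.card_eq.symm k

end BoundaryPair

/-- A unit step to the right, `(0, 1)`, or upwards, `(-1, 0)`. -/
def IsStep (p q : ℤ × ℤ) : Prop := q - p = (0, 1) ∨ q - p = (-1, 0)

/-- `P` is a lattice path from `p` to `q`: the list of the successive points visited. -/
def IsLatticePath (p q : ℤ × ℤ) (P : List (ℤ × ℤ)) : Prop :=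
  P.head? = some p ∧ P.getLast? = some q ∧ P.IsChain IsStep

/-- The paths `P` (the upper left one) and `P'` (the lower right one) are osculating: at every
common point `(i, j)`, `P` enters from the left and leaves upwards, while `P'` enters from below
(unless it starts there) and leaves to the right (unless it ends there). -/
def Osculating (P P' : List (ℤ × ℤ)) : Prop :=
  ∀ m m' : ℕ, ∀ i j : ℤ, P[m]? = some (i, j) → P'[m']? = some (i, j) →
    (0 < m ∧ P[m - 1]? = some (i, j - 1)) ∧
    P[m + 1]? = some (i - 1, j) ∧
    (m' ≠ 0 → P'[m' - 1]? = some (i + 1, j)) ∧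
    (m' + 1 ≠ P'.length → P'[m' + 1]? = some (i, j + 1))

/-- The set of tuples of osculating paths, the `k`-th path going from `(a, β_k)` to
`(α_k, b)`. -/
def OP {a b : ℕ} (B : BoundaryPair a b) : Set (Fin B.r → List (ℤ × ℤ)) :=
  {P | (∀ k, IsLatticePath ((a : ℤ), B.βSeq k) (B.αSeq k, (b : ℤ)) (P k)) ∧
    ∀ k k' : Fin B.r, (k' : ℕ) = k + 1 → Osculating (P k) (P k')}

/-- The rectangle `[a] × [b]`. -/
noncomputable def rectangle (a b : ℕ) : Finset (ℤ × ℤ) := Finset.Icc 1 (a : ℤ) ×ˢ Finset.Icc 1 (b : ℤ)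

/-- The vacancies of a tuple of paths: the points of the rectangle on no path. -/
noncomputable def vacancies (a b : ℕ) {r : ℕ} (P : Fin r → List (ℤ × ℤ)) : Finset (ℤ × ℤ) :=
  (rectangle a b).filter fun p => ∀ k, p ∉ P k

/-- The osculations of a tuple of paths: the points common to two of the paths. -/
noncomputable def osculations (a b : ℕ) {r : ℕ} (P : Fin r → List (ℤ × ℤ)) : Finset (ℤ × ℤ) :=
  (rectangle a b).filter fun p => ∃ k k', k ≠ k' ∧ p ∈ P k ∧ p ∈ P k'

/-- The vacancy-osculation set `Z(P)`. -/
noncomputable def vacOsc (a b : ℕ) {r : ℕ} (P : Fin r → List (ℤ × ℤ)) : Finset (ℤ × ℤ) :=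
  vacancies a b P ∪ osculations a b P

/-- `VOS(a, b, α, β, l)`: the vacancy-osculation sets with `l` elements of the tuples of osculating
paths with boundary points `(α, β)`. -/
def VOS {a b : ℕ} (B : BoundaryPair a b) (l : ℕ) : Set (Finset (ℤ × ℤ)) :=
  vacOsc a b '' {P | P ∈ OP B ∧ (vacOsc a b P).card = l}

/-! ### Partitions

Partitions are represented by their Young diagrams. Mathlib's `YoungDiagram` has cells `(i, j)`
with row `i` and column `j` counted from `0`; this does not change the content `j - i`. -/

namespace YoungDiagram

/-- The partition `(γ₁, …, γ_r | δ₁, …, δ_r)` in Frobenius notation, for strictly decreasing `γ` and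
`δ`: the smallest Young diagram in which, with `k` counted from `0`, row `k` extends at least `γ_k`
cells to the right of the diagonal cell `(k, k)` and column `k` extends at least `δ_k` cells below
it. For strictly decreasing `γ` and `δ` the lengths are exactly these and the rank is `r`,
see `rowLen_ofFrobenius`, `colLen_ofFrobenius`, `diag_ofFrobenius`. -/
def ofFrobenius {r : ℕ} (γ δ : Fin r → ℕ) : YoungDiagram where
  cells := Finset.univ.biUnion fun k : Fin r =>
    (Finset.range (k + 1) ×ˢ Finset.range (k + γ k + 1)) ∪
    (Finset.range (k + δ k + 1) ×ˢ Finset.range (k + 1))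
  isLowerSet := by
    rintro ⟨i, j⟩ ⟨i', j'⟩ ⟨hi, hj⟩ h
    simp only [Finset.coe_biUnion, Finset.coe_union, Finset.coe_product, Set.mem_iUnion,
      Set.mem_union, Set.mem_prod, Finset.mem_coe, Finset.mem_range, Finset.mem_univ] at *
    obtain ⟨k, hk, h⟩ := h
    exact ⟨k, hk, by omega⟩

theorem mem_ofFrobenius {r : ℕ} (γ δ : Fin r → ℕ) (i j : ℕ) :
    (i, j) ∈ ofFrobenius γ δ ↔
      ∃ k : Fin r, (i ≤ k ∧ j ≤ k + γ k) ∨ (i ≤ k + δ k ∧ j ≤ k) := by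
  simp [ofFrobenius, ← YoungDiagram.mem_cells]

theorem strictAnti_add_le {r : ℕ} {γ : Fin r → ℕ} (hγ : StrictAnti γ) :
    ∀ {k m : Fin r}, k ≤ m → (m : ℕ) + γ m ≤ k + γ k := by
  have key : ∀ d : ℕ, ∀ k m : Fin r, (m : ℕ) = k + d → (m : ℕ) + γ m ≤ k + γ k := by
    intro d
    induction d with
    | zero =>
      intro k m h
      have : m = k := Fin.ext (by omega)
      rw [this]
    | succ d ih =>
      intro k m h
      have hm := m.2
      have h1 := ih k ⟨k + d, by omega⟩ rfl
      have h2 : γ m < γ ⟨k + d, by omega⟩ := hγ (Fin.lt_def.2 (by simp; omega))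
      simp only at h1
      omega
  intro k m h
  exact key (m - k) k m (by have := Fin.le_def.1 h; omega)

theorem rowLen_ofFrobenius {r : ℕ} {γ δ : Fin r → ℕ} (hγ : StrictAnti γ) (k : Fin r) :
    (ofFrobenius γ δ).rowLen k = k + γ k + 1 := by
  have h : ∀ j, j < (ofFrobenius γ δ).rowLen k ↔ j < k + γ k + 1 := by
    intro j
    rw [← mem_iff_lt_rowLen, mem_ofFrobenius]
    constructor
    · rintro ⟨m, h | h⟩
      · have := strictAnti_add_le hγ (Fin.le_def.2 h.1)
        omega
      · rcases le_total k m with hm | hm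
        · have := strictAnti_add_le hγ hm
          omega
        · have := Fin.le_def.1 hm
          omega
    · intro h
      exact ⟨k, Or.inl ⟨le_rfl, by omega⟩⟩
  exact le_antisymm (not_lt.1 fun h' => by have := (h _).1 h'; omega)
    (not_lt.1 fun h' => by have := (h _).2 h'; omega)

theorem colLen_ofFrobenius {r : ℕ} {γ δ : Fin r → ℕ} (hδ : StrictAnti δ) (k : Fin r) :
    (ofFrobenius γ δ).colLen k = k + δ k + 1 := by
  have h : (ofFrobenius γ δ).transpose = ofFrobenius δ γ := by
    ext ⟨i, j⟩
    rw [mem_cells, mem_cells, mem_transpose, Prod.swap_prod_mk, mem_ofFrobenius, mem_ofFrobenius]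
    exact exists_congr fun k => by tauto
  rw [← rowLen_transpose, h, rowLen_ofFrobenius hδ]

theorem diag_ofFrobenius {r : ℕ} (γ δ : Fin r → ℕ) (i : ℕ) :
    (i, i) ∈ ofFrobenius γ δ ↔ i < r := by
  rw [mem_ofFrobenius]
  constructor
  · rintro ⟨k, h | h⟩ <;> omega
  · intro h
    exact ⟨⟨i, h⟩, Or.inl ⟨le_rfl, by simp⟩⟩

/-- The `(a, b)`-complement `[a] × [b] \ μ = (b - μ_a, …, b - μ_1)` of a partition `μ` whose Young
diagram fits into the rectangle: the complement of the diagram, rotated by a half-turn. -/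
def rectCompl (a b : ℕ) (μ : YoungDiagram) : YoungDiagram where
  cells := (Finset.range a ×ˢ Finset.range b).filter fun c => (a - 1 - c.1, b - 1 - c.2) ∉ μ
  isLowerSet := by
    rintro ⟨i, j⟩ ⟨i', j'⟩ ⟨hi, hj⟩ h
    simp only [Finset.coe_filter, Finset.mem_product, Finset.mem_range, Set.mem_ofPred_eq] at *
    refine ⟨by omega, fun h' => h.2 (μ.up_left_mem ?_ ?_ h')⟩ <;> omega

/-- `μ` and `ν` differ by a square. -/
def DifferBySquare (μ ν : YoungDiagram) : Prop :=
  ∃ c : ℕ × ℕ, (c ∉ ν.cells ∧ μ.cells = insert c ν.cells) ∨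
    (c ∉ μ.cells ∧ ν.cells = insert c μ.cells)

/-- The diagonal difference `Δ(μ, ν)` of two partitions which differ by a square: the content of
that square, which is then the only element of the symmetric difference of the diagrams. -/
def diagDiff (μ ν : YoungDiagram) : ℤ :=
  ∑ c ∈ symmDiff μ.cells ν.cells, ((c.2 : ℤ) - (c.1 : ℤ))

end YoungDiagram

/-- The partition `λ_{a,b,α,β} = [a] × [b] \ (b - β₁, …, b - β_r | a - α₁, …, a - α_r)`. -/
def BoundaryPair.partition {a b : ℕ} (B : BoundaryPair a b) : YoungDiagram :=
  YoungDiagram.rectCompl a b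
    (YoungDiagram.ofFrobenius (fun k => ((b : ℤ) - B.βSeq k).toNat)
      (fun k => ((a : ℤ) - B.αSeq k).toNat))

/-! ### Oscillating tableaux -/

/-- The sequence `η = (η₀, …, η_l)` of partitions starts with the empty partition, and successive
partitions differ by a square. -/
def IsOscTableau {l : ℕ} (η : Fin (l + 1) → YoungDiagram) : Prop :=
  η 0 = ⊥ ∧ ∀ k : Fin l, (η k.castSucc).DifferBySquare (η k.succ)

/-- The oscillating tableaux of shape `μ` and length `l`. -/
def OT (μ : YoungDiagram) (l : ℕ) : Set (Fin (l + 1) → YoungDiagram) :=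
  {η | IsOscTableau η ∧ η (Fin.last l) = μ}

/-- The profile `Ω(η)`; `profile η k` is the diagonal difference of the `k`-th pair of successive
partitions. -/
def profile {l : ℕ} (η : Fin (l + 1) → YoungDiagram) (k : Fin l) : ℤ :=
  (η k.castSucc).diagDiff (η k.succ)

/-- The generalized oscillating tableaux `GOT(T, ≺, μ, l)`. -/
def GOT (T : Set ℤ) (prec : ℤ → ℤ → Prop) (μ : YoungDiagram) (l : ℕ) :
    Set ((Fin l → ℤ) × (Fin (l + 1) → YoungDiagram)) :=
  {x | (∀ k, x.1 k ∈ T) ∧ x.2 ∈ OT μ l ∧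
    ∀ k k' : Fin l, (k' : ℕ) = k + 1 →
      x.1 k < x.1 k' ∨ (x.1 k = x.1 k' ∧ prec (profile x.2 k) (profile x.2 k'))}

/-! ### Ordering pairs and the mappings which they induce -/

/-- The content of a lattice point. -/
def content (p : ℤ × ℤ) : ℤ := p.2 - p.1

/-- An ordering pair: a level function on pairs of positive integers, with positive values, and a
total strict order on `ℤ`, which are compatible. (The values of `level` at other points of `ℤ × ℤ`
are irrelevant.) -/
structure OrderingPair where
  level : ℤ × ℤ → ℤ
  prec : ℤ → ℤ → Prop
  level_pos : ∀ p : ℤ × ℤ, 0 < p.1 → 0 < p.2 → 0 < level p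
  prec_irrefl : ∀ z, ¬ prec z z
  prec_trans : ∀ x y z, prec x y → prec y z → prec x z
  prec_total : ∀ x y, prec x y ∨ x = y ∨ prec y x
  compat : ∀ p q : ℤ × ℤ, 0 < p.1 → 0 < p.2 → 0 < q.1 → 0 < q.2 →
    (level p < level q ∨ (level p = level q ∧ prec (content p) (content q))) →
    p.1 < q.1 ∨ p.2 < q.2

/-- The order on lattice points given by an ordering pair. -/
def OrderingPair.lt (O : OrderingPair) (p q : ℤ × ℤ) : Prop :=
  O.level p < O.level q ∨ (O.level p = O.level q ∧ O.prec (content p) (content q))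

/-- The lexicographic ordering pair: level the row index, with the order `<`. -/
def lexPair : OrderingPair where
  level p := p.1
  prec x y := x < y
  level_pos _ h _ := h
  prec_irrefl := lt_irrefl
  prec_trans _ _ _ := lt_trans
  prec_total := lt_trichotomy
  compat p q _ _ _ _ h := by simp only [content] at h; omega

/-- The antilexicographic ordering pair: level the column index, with the order `>`. -/
def antilexPair : OrderingPair where
  level p := p.2
  prec x y := x > y
  level_pos _ _ h := h
  prec_irrefl := lt_irrefl
  prec_trans _ _ _ h h' := lt_trans h' h
  prec_total x y := by omega
  compat p q _ _ _ _ h := by simp only [content] at h; omega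

/-- `s = (s₁, …, s_l)` is the ordering of the set `S` induced by the ordering pair. -/
def IsInducedOrdering (O : OrderingPair) {l : ℕ} (S : Finset (ℤ × ℤ)) (s : Fin l → ℤ × ℤ) : Prop :=
  Function.Injective s ∧ Finset.univ.image s = S ∧
    ∀ k k' : Fin l, (k' : ℕ) = k + 1 → O.lt (s k) (s k')

/-- `x = (t, η)` is associated with `S` via the ordering pair: `t = (L(s₁), …, L(s_l))` and `η` is
the oscillating tableau whose profile is the sequence of contents of `s₁, …, s_l`, where `s` is the
ordering of `S` induced by the pair. -/
def IsAssociated (O : OrderingPair) {l : ℕ} (S : Finset (ℤ × ℤ))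
    (x : (Fin l → ℤ) × (Fin (l + 1) → YoungDiagram)) : Prop :=
  ∃ s : Fin l → ℤ × ℤ, IsInducedOrdering O S s ∧ (∀ k, x.1 k = O.level (s k)) ∧
    IsOscTableau x.2 ∧ ∀ k, profile x.2 k = content (s k)

/-- The mapping `Θ` induced by an ordering pair: it sends `S` to the pair `(t, η)` associated with
`S` via the ordering pair (an arbitrary value if there is none). -/
noncomputable def inducedMap (O : OrderingPair) (l : ℕ) (S : Finset (ℤ × ℤ)) :
    (Fin l → ℤ) × (Fin (l + 1) → YoungDiagram) :=
  Classical.epsilon (IsAssociated O S)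

/-- The set `{(t_k, t_k + Ω(η)_k)}`. -/
def lexInverse {l : ℕ} (x : (Fin l → ℤ) × (Fin (l + 1) → YoungDiagram)) : Finset (ℤ × ℤ) :=
  Finset.univ.image fun k => (x.1 k, x.1 k + profile x.2 k)

/-- The set `{(t_k - Ω(η)_k, t_k)}`. -/
def antilexInverse {l : ℕ} (x : (Fin l → ℤ) × (Fin (l + 1) → YoungDiagram)) : Finset (ℤ × ℤ) :=
  Finset.univ.image fun k => (x.1 k - profile x.2 k, x.1 k)

/-!
The link between the two sides of the bijection is the height function of a tuple of osculating
paths: `C i j` is the number of paths which pass on the upper left of the corner between `(i, j)`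
and `(i + 1, j + 1)`. The `k`-th path (`k = 0, 1, …`) consists of the points with
`C (i - 1) (j - 1) ≤ k < C i j`, so the number of paths through `(i, j)` is
`C i j - C (i - 1) (j - 1)`, and the vacancies and osculations are exactly the points at which `C`
does not increase by one along the diagonal. Height functions are characterized by boundary values
and by having steps zero or one along rows and columns, whence `mem_VOS_iff`: the
vacancy-osculation sets are the sets of diagonal defects of height functions. In one direction this
needs that osculating paths are nested (`Osculating.covered`) and that no three of them meet
(`eq_succ_of_mem`); in the other one, the paths are recovered from `C` by going up whenever possible
(`IsHeight.exists_mem_OP`).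

A partition `μ` is described by its boundary function `YoungDiagram.edge`, where `edge μ c` is the
first row whose cell of content `c` is not in `μ`. Boundary functions are antitone with steps zero
and minus one, and are otherwise determined by their behaviour near infinity
(`YoungDiagram.exists_edge_eq`). Partitions differ by a square of content `c` if and only if their
boundary functions differ by one at `c` and agree elsewhere.

Suppose now that `α = [a]`. The two descriptions are translated into each other by
`edge c = i - C i (i + c)`, for the partition reached when the rectangle has been read up to row
`i` (or up to row `i` on the diagonal of content `c` only, in the middle of a row). Reading
`(i, j)` changes the boundary function on the diagonal of `(i, j)` by
`1 + C (i - 1) (j - 1) - C i j`, that is, it adds a square at a vacancy, removes one at an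
osculation, and does nothing otherwise (`IsExtHeight.exists_associated`). Conversely, steps of `C`
along rows are steps of the boundary functions of the partitions at the ends of rows, and steps
along columns are steps of those of the partitions in the middle of rows (`GOT.exists_ext`).
Starting from the empty partition before row `1` and from `λ` after row `a`, these steps also force
the boundary values of `C`, and hence that the points lie in the rectangle.

The case `β = [b]` follows by transposing the height function and all partitions.
-/

/-! ### Lattice paths -/

theorem isStep_iff {p q : ℤ × ℤ} :
    IsStep p q ↔ (q.1 = p.1 ∧ q.2 = p.2 + 1) ∨ (q.1 = p.1 - 1 ∧ q.2 = p.2) := by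
  obtain ⟨p1, p2⟩ := p
  obtain ⟨q1, q2⟩ := q
  simp only [IsStep, Prod.mk_sub_mk, Prod.mk.injEq]
  omega

theorem IsStep.content_eq {p q : ℤ × ℤ} (h : IsStep p q) : content q = content p + 1 := by
  rw [isStep_iff] at h
  simp only [content]
  omega

theorem isLatticePath_singleton (p : ℤ × ℤ) : IsLatticePath p p [p] := by
  simp [IsLatticePath]

theorem IsLatticePath.cons {p p' q : ℤ × ℤ} {P : List (ℤ × ℤ)} (hs : IsStep p p')
    (h : IsLatticePath p' q P) : IsLatticePath p q (p :: P) := by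
  obtain ⟨h1, h2, h3⟩ := h
  cases P with
  | nil => simp at h1
  | cons x P =>
    simp only [List.head?_cons, Option.some.injEq] at h1
    subst h1
    exact ⟨rfl, by simpa using h2, List.isChain_cons_cons.2 ⟨hs, h3⟩⟩

theorem IsLatticePath.cases_cons {p q x : ℤ × ℤ} {P : List (ℤ × ℤ)}
    (h : IsLatticePath p q (x :: P)) :
    x = p ∧ ((P = [] ∧ p = q) ∨ ∃ p', IsStep p p' ∧ IsLatticePath p' q P) := by
  obtain ⟨h1, h2, h3⟩ := h
  simp only [List.head?_cons, Option.some.injEq] at h1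
  subst h1
  refine ⟨rfl, ?_⟩
  cases P with
  | nil => left; simpa using h2
  | cons y P =>
    right
    rw [List.isChain_cons_cons] at h3
    exact ⟨y, h3.1, rfl, by simpa using h2, h3.2⟩

/-- Each step raises the content by one, so the position of a point on a lattice path is the
difference of its content and that of the initial point. -/
theorem IsLatticePath.content_getElem? {p q : ℤ × ℤ} {P : List (ℤ × ℤ)}
    (h : IsLatticePath p q P) {m : ℕ} {x : ℤ × ℤ} (hx : P[m]? = some x) :
    content x = content p + m := by
  induction P generalizing p m with
  | nil => simp at hx
  | cons y P ih =>
    obtain ⟨rfl, h' | ⟨p', hs, h'⟩⟩ := h.cases_cons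
    · obtain ⟨rfl, rfl⟩ := h'
      cases m with
      | zero => simp at hx; simp [hx]
      | succ m => simp at hx
    · cases m with
      | zero => simp at hx; simp [hx]
      | succ m =>
        have := ih h' (by simpa using hx)
        rw [this, hs.content_eq]
        push_cast
        ring

theorem IsLatticePath.start_mem {p q : ℤ × ℤ} {P : List (ℤ × ℤ)} (h : IsLatticePath p q P) :
    p ∈ P := List.mem_of_mem_head? h.1

theorem IsLatticePath.end_mem {p q : ℤ × ℤ} {P : List (ℤ × ℤ)} (h : IsLatticePath p q P) :
    q ∈ P := List.mem_of_mem_getLast? h.2.1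

theorem IsLatticePath.eq_of_content_eq {p q : ℤ × ℤ} {P : List (ℤ × ℤ)}
    (h : IsLatticePath p q P) {x y : ℤ × ℤ} (hx : x ∈ P) (hy : y ∈ P)
    (hxy : content x = content y) : x = y := by
  obtain ⟨m, hm⟩ := List.mem_iff_getElem?.1 hx
  obtain ⟨n, hn⟩ := List.mem_iff_getElem?.1 hy
  have h1 := h.content_getElem? hm
  have h2 := h.content_getElem? hn
  have : m = n := by omega
  subst this
  rw [hm] at hn
  exact Option.some.inj hn

theorem IsLatticePath.getElem?_iff {p q : ℤ × ℤ} {P : List (ℤ × ℤ)}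
    (h : IsLatticePath p q P) {m : ℕ} {x : ℤ × ℤ} :
    P[m]? = some x ↔ x ∈ P ∧ content x = content p + m := by
  refine ⟨fun hx => ⟨List.mem_of_getElem? hx, h.content_getElem? hx⟩, fun ⟨hx, hc⟩ => ?_⟩
  obtain ⟨n, hn⟩ := List.mem_iff_getElem?.1 hx
  have := h.content_getElem? hn
  have : m = n := by omega
  rwa [this]

theorem IsLatticePath.content_end {p q : ℤ × ℤ} {P : List (ℤ × ℤ)}
    (h : IsLatticePath p q P) : content q + 1 = content p + P.length := by
  have h2 := h.2.1
  rw [List.getLast?_eq_getElem?] at h2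
  have h3 := h.content_getElem? h2
  have : P.length ≠ 0 := by
    intro h0
    rw [List.length_eq_zero_iff] at h0
    simp [h0] at h2
  omega

theorem IsLatticePath.exists_succ {p q : ℤ × ℤ} {P : List (ℤ × ℤ)} (h : IsLatticePath p q P)
    {x : ℤ × ℤ} (hx : x ∈ P) (hq : x ≠ q) : ∃ y ∈ P, IsStep x y := by
  induction P generalizing p with
  | nil => simp at hx
  | cons z P ih =>
    obtain ⟨rfl, h' | ⟨p', hs, h'⟩⟩ := h.cases_cons
    · obtain ⟨rfl, rfl⟩ := h'
      simp at hx
      exact absurd hx hq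
    · rcases List.mem_cons.1 hx with rfl | hx
      · exact ⟨p', List.mem_cons_of_mem _ h'.start_mem, hs⟩
      · obtain ⟨y, hy, hxy⟩ := ih h' hx
        exact ⟨y, List.mem_cons_of_mem _ hy, hxy⟩

theorem IsLatticePath.exists_pred {p q : ℤ × ℤ} {P : List (ℤ × ℤ)} (h : IsLatticePath p q P)
    {x : ℤ × ℤ} (hx : x ∈ P) (hp : x ≠ p) : ∃ y ∈ P, IsStep y x := by
  induction P generalizing p with
  | nil => simp at hx
  | cons z P ih =>
    obtain ⟨rfl, h' | ⟨p', hs, h'⟩⟩ := h.cases_cons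
    · obtain ⟨rfl, rfl⟩ := h'
      simp at hx
      exact absurd hx hp
    · rcases List.mem_cons.1 hx with rfl | hx
      · exact absurd rfl hp
      · by_cases hxp : x = p'
        · subst hxp
          exact ⟨_, List.mem_cons_self, hs⟩
        · obtain ⟨y, hy, hxy⟩ := ih h' hx hxp
          exact ⟨y, List.mem_cons_of_mem _ hy, hxy⟩

theorem IsLatticePath.le_start {p q : ℤ × ℤ} {P : List (ℤ × ℤ)} (h : IsLatticePath p q P)
    {x : ℤ × ℤ} (hx : x ∈ P) : x.1 ≤ p.1 ∧ p.2 ≤ x.2 := by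
  induction P generalizing p with
  | nil => simp at hx
  | cons z P ih =>
    obtain ⟨rfl, h' | ⟨p', hs, h'⟩⟩ := h.cases_cons
    · obtain ⟨rfl, rfl⟩ := h'
      simp at hx
      simp [hx]
    · rcases List.mem_cons.1 hx with rfl | hx
      · simp
      · have := ih h' hx
        rw [isStep_iff] at hs
        omega

theorem IsLatticePath.end_le {p q : ℤ × ℤ} {P : List (ℤ × ℤ)} (h : IsLatticePath p q P)
    {x : ℤ × ℤ} (hx : x ∈ P) : q.1 ≤ x.1 ∧ x.2 ≤ q.2 := by
  induction P generalizing p x with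
  | nil => simp at hx
  | cons z P ih =>
    obtain ⟨rfl, h' | ⟨p', hs, h'⟩⟩ := h.cases_cons
    · obtain ⟨rfl, rfl⟩ := h'
      simp at hx
      simp [hx]
    · rcases List.mem_cons.1 hx with rfl | hx
      · have := ih h' h'.start_mem
        rw [isStep_iff] at hs
        omega
      · exact ih h' hx

/-- For lattice paths, the condition of osculating concerns only the sets of points. -/
theorem osculating_iff {p q p' q' : ℤ × ℤ} {P P' : List (ℤ × ℤ)} (h : IsLatticePath p q P)
    (h' : IsLatticePath p' q' P') :
    Osculating P P' ↔ ∀ i j : ℤ, (i, j) ∈ P → (i, j) ∈ P' →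
      (i, j - 1) ∈ P ∧ (i - 1, j) ∈ P ∧ ((i, j) ≠ p' → (i + 1, j) ∈ P') ∧
        ((i, j) ≠ q' → (i, j + 1) ∈ P') := by
  have hend := h'.content_end
  constructor
  · intro H i j hP hP'
    obtain ⟨m, hm⟩ := List.mem_iff_getElem?.1 hP
    obtain ⟨m', hm'⟩ := List.mem_iff_getElem?.1 hP'
    obtain ⟨h1, h2, h3, h4⟩ := H m m' i j hm hm'
    have hc := h'.content_getElem? hm'
    refine ⟨List.mem_of_getElem? h1.2, List.mem_of_getElem? h2, fun hne => ?_, fun hne => ?_⟩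
    · refine List.mem_of_getElem? (h3 fun h0 => hne ?_)
      exact h'.eq_of_content_eq hP' h'.start_mem (by rw [hc, h0]; simp)
    · refine List.mem_of_getElem? (h4 fun h0 => hne ?_)
      exact h'.eq_of_content_eq hP' h'.end_mem (by omega)
  · intro H m m' i j hm hm'
    obtain ⟨h1, h2, h3, h4⟩ := H i j (List.mem_of_getElem? hm) (List.mem_of_getElem? hm')
    have hc := h.content_getElem? hm
    have hc' := h'.content_getElem? hm'
    obtain ⟨n, hn⟩ := List.mem_iff_getElem?.1 h1
    have hcn := h.content_getElem? hn
    rw [h.getElem?_iff, h.getElem?_iff, h'.getElem?_iff, h'.getElem?_iff]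
    simp only [content] at *
    refine ⟨⟨by omega, h1, by omega⟩, ⟨h2, by push_cast; omega⟩, fun h0 => ⟨h3 ?_, by omega⟩,
      fun h0 => ⟨h4 ?_, by push_cast; omega⟩⟩
    · rintro rfl
      omega
    · rintro rfl
      omega

/-! ### Counting -/

/-- A lower set of `Fin n` consists of the elements less than its cardinality. -/
theorem lt_card_filter_iff {n : ℕ} {p : Fin n → Prop} [DecidablePred p]
    (hp : ∀ k k' : Fin n, k ≤ k' → p k' → p k) (k : Fin n) :
    (k : ℕ) < (Finset.univ.filter p).card ↔ p k := by
  constructor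
  · intro h
    by_contra hk
    have : Finset.univ.filter p ⊆ Finset.Iio k := by
      intro m hm
      rw [Finset.mem_filter] at hm
      rw [Finset.mem_Iio]
      by_contra hmk
      exact hk (hp _ _ (not_lt.1 hmk) hm.2)
    have := Finset.card_le_card this
    rw [Fin.card_Iio] at this
    omega
  · intro h
    have : Finset.Iic k ⊆ Finset.univ.filter p := by
      intro m hm
      rw [Finset.mem_Iic] at hm
      simp [hp _ _ hm h]
    have := Finset.card_le_card this
    rw [Fin.card_Iic] at this
    omega

theorem card_filter_orderEmbOfFin {s : Finset ℤ} {n : ℕ} (h : s.card = n) (x : ℤ) :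
    (Finset.univ.filter fun k => s.orderEmbOfFin h k ≤ x).card = (s.filter (· ≤ x)).card := by
  rw [← Finset.card_map (s.orderEmbOfFin h).toEmbedding]
  congr 1
  ext y
  simp only [Finset.mem_map, Finset.mem_filter, Finset.mem_univ, true_and,
    RelEmbedding.coe_toEmbedding]
  constructor
  · rintro ⟨k, hk, rfl⟩
    exact ⟨Finset.orderEmbOfFin_mem _ _ _, hk⟩
  · rintro ⟨hy, hyx⟩
    have : y ∈ Set.range (s.orderEmbOfFin h) := by rw [Finset.range_orderEmbOfFin]; exact hy
    obtain ⟨k, rfl⟩ := this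
    exact ⟨k, hyx, rfl⟩

/-- The `k`-th smallest element of `s` is at most `x` exactly if `s` has more than `k` elements
up to `x`. -/
theorem orderEmbOfFin_le_iff {s : Finset ℤ} {n : ℕ} (h : s.card = n) (x : ℤ) (k : Fin n) :
    s.orderEmbOfFin h k ≤ x ↔ (k : ℕ) < (s.filter (· ≤ x)).card := by
  rw [← card_filter_orderEmbOfFin h,
    lt_card_filter_iff (p := fun k => s.orderEmbOfFin h k ≤ x)
      (fun k k' hk hk' => ((s.orderEmbOfFin h).monotone hk).trans hk')]

namespace BoundaryPair

variable {a b : ℕ} (B : BoundaryPair a b)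

theorem αSeq_le_iff (k : Fin B.r) (x : ℤ) :
    B.αSeq k ≤ x ↔ (k : ℕ) < (B.α.filter (· ≤ x)).card := orderEmbOfFin_le_iff _ _ _

theorem βSeq_le_iff (k : Fin B.r) (x : ℤ) :
    B.βSeq k ≤ x ↔ (k : ℕ) < (B.β.filter (· ≤ x)).card := orderEmbOfFin_le_iff _ _ _

theorem card_αSeq_le (x : ℤ) :
    (Finset.univ.filter fun k => B.αSeq k ≤ x).card = (B.α.filter (· ≤ x)).card :=
  card_filter_orderEmbOfFin _ _

theorem card_βSeq_le (x : ℤ) :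
    (Finset.univ.filter fun k => B.βSeq k ≤ x).card = (B.β.filter (· ≤ x)).card :=
  card_filter_orderEmbOfFin _ _

theorem αSeq_mem (k : Fin B.r) : 1 ≤ B.αSeq k ∧ B.αSeq k ≤ a :=
  Finset.mem_Icc.1 (B.α_subset (Finset.orderEmbOfFin_mem _ _ _))

theorem βSeq_mem (k : Fin B.r) : 1 ≤ B.βSeq k ∧ B.βSeq k ≤ b :=
  Finset.mem_Icc.1 (B.β_subset (Finset.orderEmbOfFin_mem _ _ _))

theorem βSeq_lt {k k' : Fin B.r} (h : k < k') : B.βSeq k < B.βSeq k' :=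
  (B.β.orderEmbOfFin B.card_eq.symm).strictMono h

end BoundaryPair

/-! ### Height functions -/

/-- Height functions on `[0, a] × [0, b]` with boundary values given by `(α, β)`: `C i j` is to be
thought of as the number of paths which pass on the upper left of the corner between `(i, j)` and
`(i + 1, j + 1)`, that is, which enter row `i` from below (or start, if `i = a`) in one of the
columns `1, …, j`. They generalize the corner sum matrices of alternating sign matrices. -/
structure IsHeight {a b : ℕ} (B : BoundaryPair a b) (C : ℤ → ℤ → ℤ) : Prop where
  left : ∀ i : ℤ, 0 ≤ i → i ≤ a → C i 0 = 0
  top : ∀ j : ℤ, 0 ≤ j → j ≤ b → C 0 j = 0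
  right : ∀ i : ℤ, 0 ≤ i → i ≤ a → C i b = (B.α.filter (· ≤ i)).card
  bottom : ∀ j : ℤ, 0 ≤ j → j ≤ b → C a j = (B.β.filter (· ≤ j)).card
  row_step : ∀ i j : ℤ, 0 ≤ i → i ≤ a → 1 ≤ j → j ≤ b →
    C i (j - 1) ≤ C i j ∧ C i j ≤ C i (j - 1) + 1
  col_step : ∀ i j : ℤ, 1 ≤ i → i ≤ a → 0 ≤ j → j ≤ b →
    C (i - 1) j ≤ C i j ∧ C i j ≤ C (i - 1) j + 1

/-- The points of the rectangle at which a height function does not increase by exactly one along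
the diagonal. -/
noncomputable def diagonalDefects (a b : ℕ) (C : ℤ → ℤ → ℤ) : Finset (ℤ × ℤ) :=
  (rectangle a b).filter fun p => C p.1 p.2 ≠ C (p.1 - 1) (p.2 - 1) + 1

theorem mem_rectangle {a b : ℕ} {i j : ℤ} :
    (i, j) ∈ rectangle a b ↔ (1 ≤ i ∧ i ≤ a) ∧ 1 ≤ j ∧ j ≤ b := by
  simp [rectangle]

/-! ### From osculating paths to height functions -/

/-- The point `(i, j)` lies weakly to the lower right of the path `P`, on a diagonal which meets
`P`. -/
def Covered (P : List (ℤ × ℤ)) (i j : ℤ) : Prop := ∃ n : ℕ, (i - n, j - n) ∈ P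

section Covered

variable {p q : ℤ × ℤ} {P : List (ℤ × ℤ)}

theorem Covered.of_mem {i j : ℤ} (h : (i, j) ∈ P) : Covered P i j := ⟨0, by simpa using h⟩

theorem Covered.shift {i j : ℤ} (n : ℕ) (h : Covered P (i - n) (j - n)) : Covered P i j := by
  obtain ⟨m, hm⟩ := h
  refine ⟨n + m, ?_⟩
  push_cast
  rwa [← sub_sub, ← sub_sub]

theorem covered_iff {i j : ℤ} : Covered P i j ↔ (i, j) ∈ P ∨ Covered P (i - 1) (j - 1) := by
  constructor
  · rintro ⟨n | n, hn⟩
    · left; simpa using hn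
    · right
      refine ⟨n, ?_⟩
      push_cast at hn
      convert hn using 2 <;> ring
  · rintro (h | h)
    · exact .of_mem h
    · exact Covered.shift 1 (by simpa using h)

theorem IsLatticePath.not_covered_of_mem (h : IsLatticePath p q P) {i j : ℤ} (hp : (i, j) ∈ P) :
    ¬ Covered P (i - 1) (j - 1) := by
  rintro ⟨n, hn⟩
  have := h.eq_of_content_eq hp hn (by simp only [content]; ring)
  rw [Prod.mk.injEq] at this
  omega

theorem IsLatticePath.covered_row (h : IsLatticePath p q P) {i j : ℤ} (hj : j ≤ q.2)
    (hc : Covered P i (j - 1)) : Covered P i j := by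
  obtain ⟨n, hn⟩ := hc
  obtain ⟨⟨y1, y2⟩, hy, hs⟩ := h.exists_succ hn (by rintro rfl; simp only at hj; omega)
  rw [isStep_iff] at hs
  rcases hs with hs | hs
  · refine ⟨n, ?_⟩
    convert hy using 2 <;> simp only at hs <;> omega
  · refine ⟨n + 1, ?_⟩
    convert hy using 2 <;> simp only at hs <;> push_cast <;> omega

theorem IsLatticePath.covered_col (h : IsLatticePath p q P) {i j : ℤ} (hi : i ≤ p.1)
    (hc : Covered P (i - 1) j) : Covered P i j := by
  obtain ⟨n, hn⟩ := hc
  obtain ⟨⟨y1, y2⟩, hy, hs⟩ := h.exists_pred hn (by rintro rfl; simp only at hi; omega)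
  rw [isStep_iff] at hs
  rcases hs with hs | hs
  · refine ⟨n + 1, ?_⟩
    convert hy using 2 <;> simp only at hs <;> push_cast <;> omega
  · refine ⟨n, ?_⟩
    convert hy using 2 <;> simp only at hs <;> omega

theorem IsLatticePath.covered_row_of_le (h : IsLatticePath p q P) {i j j' : ℤ} (hjj : j ≤ j')
    (hj : j' ≤ q.2) (hc : Covered P i j) : Covered P i j' := by
  induction j', hjj using Int.leInduction with
  | base => exact hc
  | succ k hk ih => exact h.covered_row hj (by simpa using ih (by omega))

theorem IsLatticePath.covered_col_of_le (h : IsLatticePath p q P) {i i' j : ℤ} (hii : i ≤ i')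
    (hi : i' ≤ p.1) (hc : Covered P i j) : Covered P i' j := by
  induction i', hii using Int.leInduction with
  | base => exact hc
  | succ k hk ih => exact h.covered_col hi (by simpa using ih (by omega))

/-- Where covering begins along a row, the path enters from below (or starts). -/
theorem IsLatticePath.row_jump (h : IsLatticePath p q P) {i j : ℤ} (hc : Covered P i j)
    (hn : ¬ Covered P i (j - 1)) (hi : i ≤ p.1) : (i, j) ∈ P ∧ (i, j - 1) ∉ P := by
  refine ⟨?_, fun h' => hn (.of_mem h')⟩
  rcases covered_iff.1 hc with h' | h'
  · exact h'
  · exact absurd (h.covered_col hi h') hn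

/-- Where covering begins along a column, the path leaves to the right (or ends). -/
theorem IsLatticePath.col_jump (h : IsLatticePath p q P) {i j : ℤ} (hc : Covered P i j)
    (hn : ¬ Covered P (i - 1) j) (hj : j ≤ q.2) : (i, j) ∈ P ∧ (i - 1, j) ∉ P := by
  refine ⟨?_, fun h' => hn (.of_mem h')⟩
  rcases covered_iff.1 hc with h' | h'
  · exact h'
  · exact absurd (h.covered_row hj h') hn

/-- Osculating paths are nested: all points of the lower right path are covered by the upper left
one. At a common point the lower right path cannot turn upwards, so it never gets through. -/
theorem Osculating.covered {p' q' : ℤ × ℤ} {P' : List (ℤ × ℤ)} (h : IsLatticePath p q P)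
    (h' : IsLatticePath p' q' P') (hO : Osculating P P') (hp : p.1 = p'.1) (hp2 : p.2 ≤ p'.2)
    (hq : q.2 = q'.2) {x : ℤ × ℤ} (hx : x ∈ P') : Covered P x.1 x.2 := by
  rw [osculating_iff h h'] at hO
  obtain ⟨m, hm⟩ := List.mem_iff_getElem?.1 hx
  induction m generalizing x with
  | zero =>
    have : x = p' := h'.eq_of_content_eq hx h'.start_mem (by simpa using h'.content_getElem? hm)
    subst this
    exact h.covered_row_of_le hp2 (hq ▸ (h'.end_le hx).2) (.of_mem (hp ▸ h.start_mem))
  | succ m ih =>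
    have hc := h'.content_getElem? hm
    obtain ⟨y, hy, hs⟩ := h'.exists_pred hx (by rintro rfl; push_cast at hc; omega)
    have hcy := hs.content_eq
    have hcov := ih hy ((h'.getElem?_iff).2 ⟨hy, by push_cast at hc; omega⟩)
    obtain ⟨x1, x2⟩ := x
    obtain ⟨y1, y2⟩ := y
    have hx2 := (h'.end_le hx).2
    rw [isStep_iff] at hs
    simp only at hs hcov hx2 ⊢
    rcases hs with ⟨rfl, rfl⟩ | ⟨rfl, rfl⟩
    · exact h.covered_row (by omega) (by simpa using hcov)
    · rcases covered_iff.1 hcov with hmem | hcov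
      · have h4 := (hO _ _ hmem hy).2.2.2 (by
          rintro rfl
          have := (h'.end_le hx).1
          simp only at this
          omega)
        have := h'.eq_of_content_eq hx h4 (by simp only [content]; ring)
        rw [Prod.mk.injEq] at this
        omega
      · exact h.covered_row (by omega) hcov

end Covered

section Nested

variable {a b : ℕ} {B : BoundaryPair a b} {P : Fin B.r → List (ℤ × ℤ)}

theorem covered_anti (hP : P ∈ OP B) {k k' : Fin B.r} (hk : k ≤ k') {i j : ℤ}
    (hc : Covered (P k') i j) : Covered (P k) i j := by
  obtain ⟨hp, hO⟩ := hP
  obtain ⟨d, hd⟩ := Nat.exists_eq_add_of_le (Fin.le_def.1 hk)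
  clear hk
  induction d generalizing k' i j with
  | zero =>
    rwa [show k = k' from Fin.ext (by omega)]
  | succ d ih =>
    have hlt := k'.2
    refine ih (k' := ⟨k + d, by omega⟩) ?_ rfl
    obtain ⟨n, hn⟩ := hc
    have hO' := hO ⟨k + d, by omega⟩ k' (by simp only; omega)
    have hβ := B.βSeq_lt (k := ⟨k + d, by omega⟩) (k' := k') (Fin.lt_def.2 (by simp only; omega))
    exact Covered.shift n (hO'.covered (hp _) (hp _) rfl hβ.le rfl hn)

/-- Two different paths through the same point are consecutive ones: of three successive
paths, the middle one would have to leave the point both upwards and to the right. -/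
theorem eq_succ_of_mem (hP : P ∈ OP B) {k k' : Fin B.r} (hk : k < k') {i j : ℤ}
    (h : (i, j) ∈ P k) (h' : (i, j) ∈ P k') : (k' : ℕ) = k + 1 := by
  have hp := hP.1
  by_contra hne
  have hlt := k'.2
  have hk' := Fin.lt_def.1 hk
  have between : ∀ m : Fin B.r, k ≤ m → m ≤ k' → (i, j) ∈ P m := by
    intro m h1 h2
    rcases covered_iff.1 (covered_anti hP h2 (.of_mem h')) with h3 | h3
    · exact h3
    · exact absurd (covered_anti hP h1 h3) ((hp k).not_covered_of_mem h)
  have m1 := between ⟨k + 1, by omega⟩ (Fin.le_def.2 (by simp)) (Fin.le_def.2 (by simp; omega))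
  have m2 := between ⟨k + 2, by omega⟩ (Fin.le_def.2 (by simp)) (Fin.le_def.2 (by simp; omega))
  have o1 := (osculating_iff (hp _) (hp _)).1 (hP.2 k ⟨k + 1, by omega⟩ rfl) i j h m1
  have o2 := (osculating_iff (hp _) (hp _)).1 (hP.2 ⟨k + 1, by omega⟩ ⟨k + 2, by omega⟩ rfl) i j
    m1 m2
  by_cases hq : (i, j) = (B.αSeq ⟨k + 1, by omega⟩, (b : ℤ))
  · have := ((hp _).end_le o2.2.1).1
    rw [Prod.mk.injEq] at hq
    simp only at this
    omega
  · have := (hp _).eq_of_content_eq (o1.2.2.2 hq) o2.2.1 (by simp only [content]; ring)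
    rw [Prod.mk.injEq] at this
    omega

open Classical in
/-- The height function of a tuple of paths: the number of paths which cover `(i, j)`. -/
noncomputable def heightOf (P : Fin B.r → List (ℤ × ℤ)) (i j : ℤ) : ℤ :=
  (Finset.univ.filter fun k => Covered (P k) i j).card

theorem card_le_one_of_forall {n : ℕ} {s : Finset (Fin n)} (h : ∀ k ∈ s, ∀ k' ∈ s, k < k' → False) :
    s.card ≤ 1 :=
  Finset.card_le_one.2 fun k hk k' hk' => by
    rcases lt_trichotomy k k' with h1 | h1 | h1
    · exact (h _ hk _ hk' h1).elim
    · exact h1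
    · exact (h _ hk' _ hk h1).elim

theorem card_filter_sub {n : ℕ} {p q : Fin n → Prop} [DecidablePred p] [DecidablePred q]
    (h : ∀ k, p k → q k) :
    ((Finset.univ.filter q).card : ℤ) =
      (Finset.univ.filter p).card + (Finset.univ.filter fun k => q k ∧ ¬ p k).card := by
  have : Finset.univ.filter q = Finset.univ.filter p ∪ Finset.univ.filter fun k => q k ∧ ¬ p k := by
    ext k
    simp only [Finset.mem_filter, Finset.mem_univ, true_and, Finset.mem_union]
    have := h k
    tauto
  rw [this, Finset.card_union_of_disjoint]
  · push_cast; rfl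
  · rw [Finset.disjoint_left]
    simp only [Finset.mem_filter, Finset.mem_univ, true_and]
    tauto

open Classical in
theorem isHeight_heightOf (hP : P ∈ OP B) : IsHeight B (heightOf P) where
  left i _ _ := by
    simp only [heightOf, Nat.cast_eq_zero, Finset.card_eq_zero, Finset.filter_eq_empty_iff]
    rintro k - ⟨n, hn⟩
    have := ((hP.1 k).le_start hn).2
    have := (B.βSeq_mem k).1
    simp only at *
    omega
  top i _ _ := by
    simp only [heightOf, Nat.cast_eq_zero, Finset.card_eq_zero, Finset.filter_eq_empty_iff]
    rintro k - ⟨n, hn⟩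
    have := ((hP.1 k).end_le hn).1
    have := (B.αSeq_mem k).1
    simp only at *
    omega
  right i _ hi := by
    rw [heightOf, ← B.card_αSeq_le]
    congr 3
    ext k
    constructor
    · rintro ⟨n, hn⟩
      have := ((hP.1 k).end_le hn).1
      simp only at *
      omega
    · intro h
      exact (hP.1 k).covered_col_of_le h hi (.of_mem (hP.1 k).end_mem)
  bottom j _ hj := by
    rw [heightOf, ← B.card_βSeq_le]
    congr 3
    ext k
    constructor
    · rintro ⟨n, hn⟩
      have := ((hP.1 k).le_start hn).2
      simp only at *
      omega
    · intro h
      exact (hP.1 k).covered_row_of_le h hj (.of_mem (hP.1 k).start_mem)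
  row_step i j h0i hi h1j hj := by
    have hsub := card_filter_sub (p := fun k => Covered (P k) i (j - 1))
      (q := fun k => Covered (P k) i j) (fun k => (hP.1 k).covered_row hj)
    have hle : (Finset.univ.filter fun k =>
        Covered (P k) i j ∧ ¬ Covered (P k) i (j - 1)).card ≤ 1 := by
      refine card_le_one_of_forall fun k hk k' hk' hlt => ?_
      simp only [Finset.mem_filter, Finset.mem_univ, true_and] at hk hk'
      obtain ⟨h1, h2⟩ := (hP.1 k).row_jump hk.1 hk.2 hi
      obtain ⟨h1', -⟩ := (hP.1 k').row_jump hk'.1 hk'.2 hi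
      have := hP.2 k k' (eq_succ_of_mem hP hlt h1 h1')
      exact h2 ((osculating_iff (hP.1 k) (hP.1 k')).1 this i j h1 h1').1
    simp only [heightOf]
    omega
  col_step i j h1i hi h0j hj := by
    have hsub := card_filter_sub (p := fun k => Covered (P k) (i - 1) j)
      (q := fun k => Covered (P k) i j) (fun k => (hP.1 k).covered_col hi)
    have hle : (Finset.univ.filter fun k =>
        Covered (P k) i j ∧ ¬ Covered (P k) (i - 1) j).card ≤ 1 := by
      refine card_le_one_of_forall fun k hk k' hk' hlt => ?_
      simp only [Finset.mem_filter, Finset.mem_univ, true_and] at hk hk'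
      obtain ⟨h1, h2⟩ := (hP.1 k).col_jump hk.1 hk.2 hj
      obtain ⟨h1', -⟩ := (hP.1 k').col_jump hk'.1 hk'.2 hj
      have := hP.2 k k' (eq_succ_of_mem hP hlt h1 h1')
      exact h2 ((osculating_iff (hP.1 k) (hP.1 k')).1 this i j h1 h1').2.1
    simp only [heightOf]
    omega

/-- The set `Z(P)` consists of the points such that the number of paths through them is not one. -/
theorem mem_vacOsc {r : ℕ} {P : Fin r → List (ℤ × ℤ)} {x : ℤ × ℤ} :
    x ∈ vacOsc a b P ↔
      x ∈ rectangle a b ∧ (Finset.univ.filter fun k => x ∈ P k).card ≠ 1 := by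
  simp only [vacOsc, vacancies, osculations, Finset.mem_union, Finset.mem_filter, ← and_or_left]
  refine and_congr_right fun _ => ?_
  rw [Ne, Finset.card_eq_one]
  constructor
  · rintro h ⟨k, hk⟩
    have hmem : ∀ m, x ∈ P m ↔ m = k := by
      intro m
      have := Finset.ext_iff.1 hk m
      simpa using this
    rcases h with h | ⟨k1, k2, hne, h1, h2⟩
    · exact h k ((hmem k).2 rfl)
    · exact hne (((hmem _).1 h1).trans ((hmem _).1 h2).symm)
  · intro h
    by_contra hcon
    push Not at hcon
    obtain ⟨⟨k, hk⟩, h2⟩ := hcon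
    refine h ⟨k, ?_⟩
    ext m
    simp only [Finset.mem_filter, Finset.mem_univ, true_and, Finset.mem_singleton]
    refine ⟨fun hm => ?_, by rintro rfl; exact hk⟩
    by_contra hne
    exact h2 m k hne hm hk

open Classical in
theorem vacOsc_eq_diagonalDefects (hP : P ∈ OP B) :
    vacOsc a b P = diagonalDefects a b (heightOf P) := by
  ext ⟨i, j⟩
  rw [mem_vacOsc, diagonalDefects, Finset.mem_filter]
  refine and_congr_right fun hr => not_congr ?_
  have hsub := card_filter_sub (p := fun k => Covered (P k) (i - 1) (j - 1))
      (q := fun k => Covered (P k) i j) (fun k h => covered_iff.2 (.inr h))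
  have : (Finset.univ.filter fun k => Covered (P k) i j ∧ ¬ Covered (P k) (i - 1) (j - 1)) =
      Finset.univ.filter fun k => (i, j) ∈ P k := by
    ext k
    simp only [Finset.mem_filter, Finset.mem_univ, true_and]
    constructor
    · rintro ⟨h1, h2⟩
      exact (covered_iff.1 h1).resolve_right h2
    · intro h
      exact ⟨.of_mem h, (hP.1 k).not_covered_of_mem h⟩
  rw [this] at hsub
  simp only [heightOf]
  omega

end Nested

/-! ### From height functions to osculating paths -/

section OnPath

/-- The point `(i, j)` lies on the `k`-th path (`k` counted from `0`) of the tuple with height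
function `C`, that is, `C` exceeds `k` for the first time on the diagonal of `(i, j)`. -/
def OnPath (a b : ℕ) (C : ℤ → ℤ → ℤ) (k i j : ℤ) : Prop :=
  (1 ≤ i ∧ i ≤ a ∧ 1 ≤ j ∧ j ≤ b) ∧ C (i - 1) (j - 1) ≤ k ∧ k < C i j

namespace IsHeight

variable {a b : ℕ} {B : BoundaryPair a b} {C : ℤ → ℤ → ℤ}

theorem row_mono (hC : IsHeight B C) {i j j' : ℤ} (h0i : 0 ≤ i) (hi : i ≤ a) (h0j : 0 ≤ j)
    (hjj : j ≤ j') (hj : j' ≤ b) : C i j ≤ C i j' := by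
  induction j', hjj using Int.leInduction with
  | base => exact le_rfl
  | succ k hk ih =>
    have := (hC.row_step i (k + 1) h0i hi (by omega) hj).1
    rw [add_sub_cancel_right] at this
    exact (ih (by omega)).trans this

theorem col_mono (hC : IsHeight B C) {i i' j : ℤ} (h0i : 0 ≤ i) (hii : i ≤ i') (hi : i' ≤ a)
    (h0j : 0 ≤ j) (hj : j ≤ b) : C i j ≤ C i' j := by
  induction i', hii using Int.leInduction with
  | base => exact le_rfl
  | succ k hk ih =>
    have := (hC.col_step (k + 1) j (by omega) hi h0j hj).1
    rw [add_sub_cancel_right] at this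
    exact (ih (by omega)).trans this

theorem mono (hC : IsHeight B C) {i i' j j' : ℤ} (h0i : 0 ≤ i) (hii : i ≤ i') (hi : i' ≤ a)
    (h0j : 0 ≤ j) (hjj : j ≤ j') (hj : j' ≤ b) : C i j ≤ C i' j' :=
  (hC.row_mono h0i (by omega) h0j hjj hj).trans (hC.col_mono h0i hii hi (by omega) hj)

theorem nonneg (hC : IsHeight B C) {i j : ℤ} (h0i : 0 ≤ i) (hi : i ≤ a) (h0j : 0 ≤ j)
    (hj : j ≤ b) : 0 ≤ C i j := by
  rw [← hC.left i h0i hi]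
  exact hC.row_mono h0i hi le_rfl h0j hj

theorem le_r (hC : IsHeight B C) {i j : ℤ} (h0i : 0 ≤ i) (hi : i ≤ a) (h0j : 0 ≤ j)
    (hj : j ≤ b) : C i j ≤ B.r := by
  refine (hC.mono h0i hi le_rfl h0j hj le_rfl).trans ?_
  rw [hC.right _ (by omega) le_rfl]
  exact_mod_cast Finset.card_filter_le _ _

theorem onPath_unique (hC : IsHeight B C) {k i j i' j' : ℤ} (h : OnPath a b C k i j)
    (h' : OnPath a b C k i' j') (hc : j - i = j' - i') : i = i' ∧ j = j' := by
  obtain ⟨h1, h2, h3⟩ := h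
  obtain ⟨h1', h2', h3'⟩ := h'
  rcases lt_trichotomy i i' with hi | hi | hi
  · have := hC.mono (i := i) (i' := i' - 1) (j := j) (j' := j' - 1) (by omega) (by omega)
      (by omega) (by omega) (by omega) (by omega)
    omega
  · omega
  · have := hC.mono (i := i') (i' := i - 1) (j := j') (j' := j - 1) (by omega) (by omega)
      (by omega) (by omega) (by omega) (by omega)
    omega

theorem onPath_up (hC : IsHeight B C) {k i j : ℤ} (hk : 0 ≤ k) (h : OnPath a b C k i j)
    (hup : k < C (i - 1) j) : OnPath a b C k (i - 1) j := by
  obtain ⟨h1, h2, h3⟩ := h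
  have hi : i ≠ 1 := by
    rintro rfl
    rw [sub_self, hC.top j (by omega) (by omega)] at hup
    omega
  refine ⟨by omega, ?_, hup⟩
  have := hC.col_step (i - 1) (j - 1) (by omega) (by omega) (by omega) (by omega)
  omega

theorem onPath_right (hC : IsHeight B C) {k i j : ℤ} (h : OnPath a b C k i j)
    (hup : C (i - 1) j ≤ k) (hj : j < b) : OnPath a b C k i (j + 1) := by
  obtain ⟨h1, h2, h3⟩ := h
  have := hC.row_step i (j + 1) (by omega) (by omega) (by omega) (by omega)
  rw [add_sub_cancel_right] at this
  exact ⟨by omega, by rwa [add_sub_cancel_right], by omega⟩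

theorem eq_αSeq (hC : IsHeight B C) {k : Fin B.r} {i : ℤ} (h1 : 1 ≤ i) (hi : i ≤ a)
    (hup : C (i - 1) b ≤ k) (h : k < C i b) : i = B.αSeq k := by
  rw [hC.right _ (by omega) (by omega)] at h hup
  have h2 := (B.αSeq_le_iff k i).2 (by omega)
  have h3 := mt (B.αSeq_le_iff k (i - 1)).1 (by omega)
  omega

/-- The part of the `k`-th path from one of its points onwards, by induction on the number `n` of
steps which would lead to the upper right corner of the rectangle. -/
theorem exists_path (hC : IsHeight B C) (k : Fin B.r) (n : ℕ) :
    ∀ i j : ℤ, OnPath a b C k i j → b - j + (i - 1) = n →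
      ∃ P, IsLatticePath (i, j) (B.αSeq k, (b : ℤ)) P ∧
        ∀ i' j', (i', j') ∈ P ↔ OnPath a b C k i' j' ∧ j - i ≤ j' - i' := by
  -- A path starting with a step from `(i, j)` to `(i₁, j₁)`.
  have step : ∀ i j i₁ j₁ : ℤ, OnPath a b C k i j → IsStep (i, j) (i₁, j₁) →
      (∃ P, IsLatticePath (i₁, j₁) (B.αSeq k, (b : ℤ)) P ∧
        ∀ i' j', (i', j') ∈ P ↔ OnPath a b C k i' j' ∧ j₁ - i₁ ≤ j' - i') →
      ∃ P, IsLatticePath (i, j) (B.αSeq k, (b : ℤ)) P ∧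
        ∀ i' j', (i', j') ∈ P ↔ OnPath a b C k i' j' ∧ j - i ≤ j' - i' := by
    rintro i j i₁ j₁ h hs ⟨P, hP, hmem⟩
    refine ⟨(i, j) :: P, hP.cons hs, fun i' j' => ?_⟩
    have hcs := hs.content_eq
    simp only [content] at hcs
    rw [List.mem_cons, hmem, Prod.mk.injEq]
    constructor
    · rintro (⟨rfl, rfl⟩ | ⟨h1, h2⟩)
      · exact ⟨h, le_rfl⟩
      · exact ⟨h1, by omega⟩
    · rintro ⟨h1, h2⟩
      by_cases hc : j - i = j' - i'
      · exact Or.inl (hC.onPath_unique h1 h hc.symm)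
      · exact Or.inr ⟨h1, by omega⟩
  have hk : (0 : ℤ) ≤ (k : ℕ) := by positivity
  induction n with
  | zero =>
    intro i j h hn
    have hb := h.1
    obtain ⟨rfl, rfl⟩ : i = 1 ∧ j = b := by omega
    have hup : C (1 - 1) b ≤ (k : ℕ) := by
      rw [sub_self, hC.top _ (by omega) (by omega)]; exact hk
    have hα := hC.eq_αSeq h.1.1 h.1.2.1 hup h.2.2
    rw [← hα]
    refine ⟨_, isLatticePath_singleton _, fun i' j' => ?_⟩
    rw [List.mem_singleton, Prod.mk.injEq]
    constructor
    · rintro ⟨rfl, rfl⟩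
      exact ⟨h, le_rfl⟩
    · rintro ⟨h1, h2⟩
      have := h1.1
      omega
  | succ n ih =>
    intro i j h hn
    by_cases hup : (k : ℕ) < C (i - 1) j
    · exact step i j (i - 1) j h (isStep_iff.2 (by simp))
        (ih _ _ (hC.onPath_up hk h hup) (by push_cast at hn; omega))
    · rw [not_lt] at hup
      by_cases hj : j < b
      · exact step i j i (j + 1) h (isStep_iff.2 (by simp))
          (ih _ _ (hC.onPath_right h hup hj) (by push_cast at hn; omega))
      · obtain rfl : j = b := by have := h.1; omega
        have hα := hC.eq_αSeq h.1.1 h.1.2.1 hup h.2.2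
        rw [← hα]
        refine ⟨_, isLatticePath_singleton _, fun i' j' => ?_⟩
        rw [List.mem_singleton, Prod.mk.injEq]
        constructor
        · rintro ⟨rfl, rfl⟩
          exact ⟨h, le_rfl⟩
        · rintro ⟨h1, h2⟩
          by_cases hc : (b : ℤ) - i = j' - i'
          · exact hC.onPath_unique h1 h hc.symm
          · obtain ⟨h1, h3, h4⟩ := h1
            obtain ⟨h5, -⟩ := h
            have := hC.mono (i := i') (i' := i - 1) (j := j') (j' := b) (by omega) (by omega)
              (by omega) (by omega) (by omega) le_rfl
            omega

theorem onPath_start (hC : IsHeight B C) (k : Fin B.r) : OnPath a b C k a (B.βSeq k) := by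
  have hβ := B.βSeq_mem k
  have ha := B.αSeq_mem k
  have h1 := (B.βSeq_le_iff k _).1 le_rfl
  have h2 := mt (B.βSeq_le_iff k (B.βSeq k - 1)).2 (by omega)
  have h3 := hC.bottom (B.βSeq k) (by omega) (by omega)
  have h4 := hC.bottom (B.βSeq k - 1) (by omega) (by omega)
  have h5 := hC.col_step a (B.βSeq k - 1) (by omega) (by omega) (by omega) (by omega)
  exact ⟨by omega, by omega, by omega⟩

theorem le_content_of_onPath (hC : IsHeight B C) {k : Fin B.r} {i j : ℤ}
    (h : OnPath a b C k i j) : B.βSeq k - a ≤ j - i := by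
  by_contra hlt
  obtain ⟨h1, h2, h3⟩ := h
  have hβ := B.βSeq_mem k
  have h4 := hC.mono (i := i) (i' := a) (j := j) (j' := j + (a - i)) (by omega) (by omega)
    (by omega) (by omega) (by omega) (by omega)
  rw [hC.bottom _ (by omega) (by omega)] at h4
  have := (B.βSeq_le_iff k (j + (a - i))).2 (by omega)
  omega

theorem exists_paths (hC : IsHeight B C) : ∃ P : Fin B.r → List (ℤ × ℤ),
    (∀ k, IsLatticePath ((a : ℤ), B.βSeq k) (B.αSeq k, (b : ℤ)) (P k)) ∧
      ∀ k i j, (i, j) ∈ P k ↔ OnPath a b C k i j := by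
  have : ∀ k : Fin B.r, ∃ P, IsLatticePath ((a : ℤ), B.βSeq k) (B.αSeq k, (b : ℤ)) P ∧
      ∀ i j, (i, j) ∈ P ↔ OnPath a b C k i j := by
    intro k
    have hs := hC.onPath_start k
    have hs1 := hs.1
    obtain ⟨P, hP, hmem⟩ := hC.exists_path k (b - B.βSeq k + (a - 1)).toNat _ _ hs (by omega)
    refine ⟨P, hP, fun i j => ?_⟩
    rw [hmem, and_iff_left_iff_imp]
    exact hC.le_content_of_onPath
  choose P h1 h2 using this
  exact ⟨P, h1, h2⟩

theorem card_filter_lt {r : ℕ} {c : ℤ} (h0 : 0 ≤ c) (hc : c ≤ r) :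
    ((Finset.univ.filter fun k : Fin r => ((k : ℕ) : ℤ) < c).card : ℤ) = c := by
  lift c to ℕ using h0
  have hc' : c ≤ r := by exact_mod_cast hc
  have : Finset.univ.filter (fun k : Fin r => ((k : ℕ) : ℤ) < c) =
      Finset.univ.map (Fin.castLEEmb hc') := by
    ext k
    simp only [Finset.mem_filter, Finset.mem_univ, true_and, Finset.mem_map, Fin.castLEEmb_apply,
      Nat.cast_lt]
    constructor
    · intro h
      exact ⟨⟨k, h⟩, rfl⟩
    · rintro ⟨m, rfl⟩
      exact m.2
  rw [this]
  simp

theorem exists_mem_OP (hC : IsHeight B C) :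
    ∃ P ∈ OP B, vacOsc a b P = diagonalDefects a b C := by
  obtain ⟨P, hP, hmem⟩ := hC.exists_paths
  refine ⟨P, ⟨hP, fun k k' hk => ?_⟩, ?_⟩
  · rw [osculating_iff (hP k) (hP k')]
    intro i j h h'
    have h1 := (hmem _ _ _).1 h
    have h1' := (hmem _ _ _).1 h'
    obtain ⟨h2, h3, h4⟩ := h1
    obtain ⟨-, -, h4'⟩ := h1'
    have c1 := hC.row_step i j (by omega) (by omega) (by omega) (by omega)
    have c2 := hC.col_step i j (by omega) (by omega) (by omega) (by omega)
    have c3 := hC.row_step (i - 1) j (by omega) (by omega) (by omega) (by omega)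
    have c4 := hC.col_step i (j - 1) (by omega) (by omega) (by omega) (by omega)
    refine ⟨?_, ?_, fun hne => ?_, fun hne => ?_⟩
    · rw [hmem]
      have hj : j ≠ 1 := by
        rintro rfl
        rw [sub_self, hC.left _ (by omega) (by omega)] at c1
        omega
      have := hC.row_step (i - 1) (j - 1) (by omega) (by omega) (by omega) (by omega)
      exact ⟨by omega, by omega, by omega⟩
    · rw [hmem]
      exact hC.onPath_up (by positivity) ⟨h2, h3, h4⟩ (by omega)
    · obtain ⟨⟨y1, y2⟩, hy, hs⟩ := (hP k').exists_pred h' hne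
      rw [isStep_iff] at hs
      simp only at hs
      rcases hs with hs | hs
      · obtain ⟨rfl, rfl⟩ : y1 = i ∧ y2 = j - 1 := by omega
        have := ((hmem _ _ _).1 hy).2.2
        omega
      · obtain ⟨rfl, rfl⟩ : y1 = i + 1 ∧ y2 = j := by omega
        exact hy
    · obtain ⟨⟨y1, y2⟩, hy, hs⟩ := (hP k').exists_succ h' hne
      rw [isStep_iff] at hs
      simp only at hs
      rcases hs with ⟨rfl, rfl⟩ | ⟨rfl, rfl⟩
      · exact hy
      · have := ((hmem _ _ _).1 hy).2.2
        omega
  · ext ⟨i, j⟩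
    rw [mem_vacOsc, diagonalDefects, Finset.mem_filter]
    refine and_congr_right fun hr => not_congr ?_
    have hr' := mem_rectangle.1 hr
    have c1 := hC.nonneg (i := i) (j := j) (by omega) (by omega) (by omega) (by omega)
    have c2 := hC.nonneg (i := i - 1) (j := j - 1) (by omega) (by omega) (by omega) (by omega)
    have c3 := hC.le_r (i := i) (j := j) (by omega) (by omega) (by omega) (by omega)
    have c4 := hC.mono (i := i - 1) (i' := i) (j := j - 1) (j' := j) (by omega) (by omega)
      (by omega) (by omega) (by omega) (by omega)
    have hsub := card_filter_sub (p := fun k : Fin B.r => ((k : ℕ) : ℤ) < C (i - 1) (j - 1))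
      (q := fun k => ((k : ℕ) : ℤ) < C i j) (fun k h => by omega)
    have heq : (Finset.univ.filter fun k : Fin B.r => (i, j) ∈ P k) =
        Finset.univ.filter fun k : Fin B.r =>
          ((k : ℕ) : ℤ) < C i j ∧ ¬ ((k : ℕ) : ℤ) < C (i - 1) (j - 1) := by
      ext k
      simp only [Finset.mem_filter, Finset.mem_univ, true_and, hmem, OnPath]
      omega
    rw [heq]
    have e1 := card_filter_lt c1 c3
    have e2 := card_filter_lt c2 (c4.trans c3)
    rw [e1, e2] at hsub
    dsimp only
    omega

end IsHeight

/-- The vacancy-osculation sets are the sets of diagonal defects of height functions. -/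
theorem mem_VOS_iff {a b : ℕ} {B : BoundaryPair a b} {l : ℕ} {S : Finset (ℤ × ℤ)} :
    S ∈ VOS B l ↔ S.card = l ∧ ∃ C, IsHeight B C ∧ S = diagonalDefects a b C := by
  constructor
  · rintro ⟨P, ⟨hP, hl⟩, rfl⟩
    exact ⟨hl, heightOf P, isHeight_heightOf hP, vacOsc_eq_diagonalDefects hP⟩
  · rintro ⟨hl, C, hC, rfl⟩
    obtain ⟨P, hP, hPC⟩ := hC.exists_mem_OP
    exact ⟨P, ⟨hP, by rwa [hPC]⟩, hPC⟩

end OnPath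

/-! ### The boundary of a Young diagram -/

namespace YoungDiagram

theorem exists_notMem_diagonal (μ : YoungDiagram) (x y : ℕ) : ∃ n, (x + n, y + n) ∉ μ := by
  obtain ⟨j, hj⟩ := μ.exists_notMem_row x
  exact ⟨j, fun h => hj (μ.up_left_mem (Nat.le_add_right _ _) (Nat.le_add_left _ _) h)⟩

/-- The boundary function of a Young diagram: the row of the first lattice point on the diagonal of
content `c` which is not a cell of the diagram. For the empty diagram it is `max 0 (-c)`; it is
antitone with steps zero and minus one, and it determines the diagram. -/
noncomputable def edge (μ : YoungDiagram) (c : ℤ) : ℤ :=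
  open Classical in (-c).toNat + Nat.find (μ.exists_notMem_diagonal (-c).toNat c.toNat)

theorem mem_iff_lt_edge (μ : YoungDiagram) (r s : ℕ) :
    (r, s) ∈ μ ↔ (r : ℤ) < μ.edge (s - r) := by
  classical
  set c : ℤ := s - r with hc
  have key : ((-c).toNat + min r s, c.toNat + min r s) = (r, s) := by
    rw [Prod.mk.injEq]; omega
  have h1 : (r : ℤ) < μ.edge c ↔
      min r s < Nat.find (μ.exists_notMem_diagonal (-c).toNat c.toNat) := by
    rw [edge]
    rw [Prod.mk.injEq] at key
    omega
  rw [h1, Nat.lt_find_iff]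
  constructor
  · intro h n hn
    rw [not_not]
    rw [Prod.mk.injEq] at key
    exact μ.up_left_mem (by omega) (by omega) h
  · intro h
    have := h _ le_rfl
    rwa [not_not, key] at this

theorem le_edge (μ : YoungDiagram) (c : ℤ) : 0 ≤ μ.edge c ∧ -c ≤ μ.edge c := by
  rw [edge]
  omega

theorem edge_eq {μ : YoungDiagram} {c e : ℤ} (h0 : 0 ≤ e) (h1 : -c ≤ e)
    (h : ∀ r s : ℕ, (s : ℤ) - r = c → ((r, s) ∈ μ ↔ (r : ℤ) < e)) : μ.edge c = e := by
  have hle := μ.le_edge c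
  rcases lt_trichotomy (μ.edge c) e with hlt | heq | hlt
  · have h2 := h (μ.edge c).toNat (μ.edge c + c).toNat (by omega)
    rw [mem_iff_lt_edge, show ((μ.edge c + c).toNat : ℤ) - (μ.edge c).toNat = c by omega] at h2
    omega
  · exact heq
  · have h2 := h e.toNat (e + c).toNat (by omega)
    rw [mem_iff_lt_edge, show ((e + c).toNat : ℤ) - e.toNat = c by omega] at h2
    omega

theorem edge_injective {μ ν : YoungDiagram} (h : ∀ c, μ.edge c = ν.edge c) : μ = ν := by
  ext ⟨r, s⟩
  rw [mem_cells, mem_cells, mem_iff_lt_edge, mem_iff_lt_edge, h]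

theorem edge_bot (c : ℤ) : (⊥ : YoungDiagram).edge c = max 0 (-c) := by
  refine edge_eq (by omega) (by omega) fun r s h => ?_
  simp only [notMem_bot, false_iff]
  omega

theorem edge_step (μ : YoungDiagram) (c : ℤ) :
    μ.edge (c + 1) ≤ μ.edge c ∧ μ.edge c ≤ μ.edge (c + 1) + 1 := by
  have h1 := μ.le_edge c
  have h2 := μ.le_edge (c + 1)
  constructor
  · by_contra hlt
    have hm : ((μ.edge c).toNat, (μ.edge c + c).toNat + 1) ∈ μ := by
      rw [mem_iff_lt_edge,
        show (((μ.edge c + c).toNat + 1 : ℕ) : ℤ) - (μ.edge c).toNat = c + 1 by omega]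
      omega
    have hm' := μ.up_left_mem le_rfl (Nat.le_succ _) hm
    rw [mem_iff_lt_edge, show ((μ.edge c + c).toNat : ℤ) - (μ.edge c).toNat = c by omega] at hm'
    omega
  · by_contra hlt
    set e := μ.edge (c + 1) with he
    have hm : (e.toNat + 1, (e + 1 + c).toNat) ∈ μ := by
      rw [mem_iff_lt_edge, show ((e + 1 + c).toNat : ℤ) - (e.toNat + 1 : ℕ) = c by omega]
      omega
    have hm' := μ.up_left_mem (Nat.le_succ _) le_rfl hm
    rw [mem_iff_lt_edge, show ((e + 1 + c).toNat : ℤ) - e.toNat = c + 1 by omega] at hm'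
    omega

/-- Every function with the properties of a boundary function is one. -/
theorem exists_edge_eq {f : ℤ → ℤ} (N : ℕ) (hf : ∀ c, f (c + 1) ≤ f c ∧ f c ≤ f (c + 1) + 1)
    (hN : ∀ c : ℤ, N ≤ c → f c = 0) (hN' : ∀ c : ℤ, c ≤ -N → f c = -c) :
    ∃ μ : YoungDiagram, ∀ c, μ.edge c = f c := by
  have anti : ∀ {c c' : ℤ}, c ≤ c' → f c' ≤ f c := by
    intro c c' h
    induction c', h using Int.leInduction with
    | base => exact le_rfl
    | succ k hk ih => exact (hf k).1.trans ih
  have mono : ∀ {c c' : ℤ}, c ≤ c' → f c + c ≤ f c' + c' := by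
    intro c c' h
    induction c', h using Int.leInduction with
    | base => exact le_rfl
    | succ k hk ih => have := (hf k).2; omega
  have h0 : ∀ c, 0 ≤ f c := by
    intro c
    rcases le_total (N : ℤ) c with h | h
    · exact (hN c h).ge
    · rw [← hN N le_rfl]; exact anti h
  have h1 : ∀ c, -c ≤ f c := by
    intro c
    rcases le_total c (-N : ℤ) with h | h
    · exact (hN' c h).ge
    · have := mono h
      have := hN' (-N) le_rfl
      omega
  have hlow : IsLowerSet (((Finset.range N ×ˢ Finset.range (2 * N)).filter
      fun x : ℕ × ℕ => (x.1 : ℤ) < f (x.2 - x.1) : Finset (ℕ × ℕ)) : Set (ℕ × ℕ)) := by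
    rintro ⟨r, s⟩ ⟨r', s'⟩ ⟨hr, hs⟩ h
    simp only [Finset.coe_filter, Finset.mem_product, Finset.mem_range, Set.mem_ofPred_eq] at *
    refine ⟨by omega, ?_⟩
    -- First move to the left, then up.
    have e1 := anti (c := (s' : ℤ) - r) (c' := s - r) (by omega)
    have e2 := mono (c := (s' : ℤ) - r) (c' := s' - r') (by omega)
    omega
  refine ⟨⟨_, hlow⟩, fun c => edge_eq (h0 c) (h1 c) fun r s hrs => ?_⟩
  rw [← mem_cells, Finset.mem_filter, Finset.mem_product, Finset.mem_range, Finset.mem_range]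
  simp only [hrs, and_iff_right_iff_imp]
  intro h
  have e1 : c < N := by
    by_contra hc
    have := hN c (by omega)
    omega
  have e2 : -N < c := by
    by_contra hc
    have := hN' c (by omega)
    omega
  have e3 := anti e2.le
  rw [hN' _ le_rfl] at e3
  omega

/-! ### Partitions which differ by a square -/

theorem diagDiff_of_eq_insert {μ ν : YoungDiagram} {x : ℕ × ℕ} (hx : x ∉ μ.cells)
    (h : ν.cells = insert x μ.cells) : μ.diagDiff ν = x.2 - x.1 := by
  have : symmDiff μ.cells ν.cells = {x} := by
    ext y
    rw [h, Finset.mem_symmDiff, Finset.mem_insert, Finset.mem_singleton]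
    constructor
    · tauto
    · rintro rfl; tauto
  rw [diagDiff, this, Finset.sum_singleton]

theorem diagDiff_comm (μ ν : YoungDiagram) : μ.diagDiff ν = ν.diagDiff μ := by
  rw [diagDiff, diagDiff, symmDiff_comm]

theorem DifferBySquare.symm {μ ν : YoungDiagram} (h : μ.DifferBySquare ν) :
    ν.DifferBySquare μ := by
  obtain ⟨c, h⟩ := h
  exact ⟨c, h.symm⟩

/-- Symmetric statements on partitions which differ by a square need a proof only if the second
partition is the larger one. -/
theorem DifferBySquare.wlog {motive : YoungDiagram → YoungDiagram → Prop} {μ ν : YoungDiagram}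
    (h : μ.DifferBySquare ν) (symm : ∀ μ ν, motive μ ν → motive ν μ)
    (add : ∀ μ ν x, x ∉ μ.cells → ν.cells = insert x μ.cells → motive μ ν) : motive μ ν := by
  obtain ⟨c, ⟨h1, h2⟩ | ⟨h1, h2⟩⟩ := h
  · exact symm _ _ (add _ _ c h1 h2)
  · exact add _ _ c h1 h2

theorem edge_of_eq_insert {μ ν : YoungDiagram} {x : ℕ × ℕ} (hx : x ∉ μ.cells)
    (h : ν.cells = insert x μ.cells) (c : ℤ) :
    ν.edge c = μ.edge c + if c = x.2 - x.1 then 1 else 0 := by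
  obtain ⟨r, s⟩ := x
  have hν : ∀ y, y ∈ ν ↔ y = (r, s) ∨ y ∈ μ := by
    intro y
    rw [← mem_cells, h, Finset.mem_insert, mem_cells]
  rw [mem_cells, mem_iff_lt_edge] at hx
  have hle := μ.le_edge c
  split_ifs with hc
  · simp only at hc
    rw [← hc] at hx
    have hr : μ.edge c = r := by
      by_cases h0 : r = 0 ∨ s = 0
      · omega
      · have h1 : (r - 1, s - 1) ∈ μ := by
          have := (hν (r - 1, s - 1)).1 (ν.up_left_mem (Nat.sub_le _ _) (Nat.sub_le _ _)
            ((hν (r, s)).2 (.inl rfl)))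
          rw [Prod.mk.injEq] at this
          exact this.resolve_left (by omega)
        rw [mem_iff_lt_edge, show ((s - 1 : ℕ) : ℤ) - (r - 1 : ℕ) = c by omega] at h1
        omega
    refine edge_eq (by omega) (by omega) fun r' s' hrs => ?_
    rw [hν, mem_iff_lt_edge, Prod.mk.injEq, hrs, hr]
    omega
  · refine edge_eq (by omega) (by omega) fun r' s' hrs => ?_
    rw [hν, mem_iff_lt_edge, Prod.mk.injEq, hrs]
    simp only at hc
    omega

theorem DifferBySquare.edge {μ ν : YoungDiagram} (h : μ.DifferBySquare ν) :
    (∀ c, c ≠ μ.diagDiff ν → ν.edge c = μ.edge c) ∧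
      (ν.edge (μ.diagDiff ν) = μ.edge (μ.diagDiff ν) + 1 ∨
        μ.edge (μ.diagDiff ν) = ν.edge (μ.diagDiff ν) + 1) := by
  refine h.wlog (motive := fun μ ν => (∀ c, c ≠ μ.diagDiff ν → ν.edge c = μ.edge c) ∧
      (ν.edge (μ.diagDiff ν) = μ.edge (μ.diagDiff ν) + 1 ∨
        μ.edge (μ.diagDiff ν) = ν.edge (μ.diagDiff ν) + 1)) (fun μ ν h => ?_) fun μ ν x hx h => ?_
  · rw [ν.diagDiff_comm μ]
    exact ⟨fun c hc => (h.1 c hc).symm, h.2.symm⟩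
  · rw [diagDiff_of_eq_insert hx h]
    exact ⟨fun c hc => by rw [edge_of_eq_insert hx h, if_neg hc, add_zero],
      .inl (by rw [edge_of_eq_insert hx h, if_pos rfl])⟩

theorem eq_insert_of_edge {μ ν : YoungDiagram} {x : ℤ} (h : ∀ c, c ≠ x → ν.edge c = μ.edge c)
    (hx : ν.edge x = μ.edge x + 1) :
    ((μ.edge x).toNat, (μ.edge x + x).toNat) ∉ μ.cells ∧
      ν.cells = insert ((μ.edge x).toNat, (μ.edge x + x).toNat) μ.cells := by
  have hle := μ.le_edge x
  constructor
  · rw [mem_cells, mem_iff_lt_edge,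
      show ((μ.edge x + x).toNat : ℤ) - (μ.edge x).toNat = x by omega]
    omega
  · ext ⟨r, s⟩
    rw [Finset.mem_insert, mem_cells, mem_cells, mem_iff_lt_edge, mem_iff_lt_edge, Prod.mk.injEq]
    by_cases hc : (s : ℤ) - r = x
    · rw [hc, hx]; omega
    · rw [h _ hc]; omega

theorem differBySquare_of_edge {μ ν : YoungDiagram} {x : ℤ}
    (h : ∀ c, c ≠ x → ν.edge c = μ.edge c)
    (hx : ν.edge x = μ.edge x + 1 ∨ μ.edge x = ν.edge x + 1) :
    μ.DifferBySquare ν ∧ μ.diagDiff ν = x := by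
  rcases hx with hx | hx
  · obtain ⟨h1, h2⟩ := eq_insert_of_edge h hx
    have hle := μ.le_edge x
    refine ⟨⟨_, .inr ⟨h1, h2⟩⟩, ?_⟩
    rw [diagDiff_of_eq_insert h1 h2]
    omega
  · obtain ⟨h1, h2⟩ := eq_insert_of_edge (fun c hc => (h c hc).symm) hx
    have hle := ν.le_edge x
    refine ⟨⟨_, .inl ⟨h1, h2⟩⟩, ?_⟩
    rw [diagDiff_comm, diagDiff_of_eq_insert h1 h2]
    omega

/-- The diagonal of the square by which two partitions differ determines one partition from the
other: on each diagonal a square can either be added or removed, but not both. -/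
theorem DifferBySquare.eq_of_diagDiff_eq {μ ν ν' : YoungDiagram} (h : μ.DifferBySquare ν)
    (h' : μ.DifferBySquare ν') (hd : μ.diagDiff ν = μ.diagDiff ν') : ν = ν' := by
  obtain ⟨h1, h2⟩ := h.edge
  obtain ⟨h1', h2'⟩ := h'.edge
  rw [← hd] at h1' h2'
  refine edge_injective fun c => ?_
  by_cases hc : c = μ.diagDiff ν
  · rw [hc]
    have e1 := ν.edge_step (μ.diagDiff ν)
    have e2 := ν'.edge_step (μ.diagDiff ν)
    rw [h1 _ (by omega)] at e1
    rw [h1' _ (by omega)] at e2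
    omega
  · rw [h1 c hc, h1' c hc]

theorem DifferBySquare.transpose {μ ν : YoungDiagram} (h : μ.DifferBySquare ν) :
    μ.transpose.DifferBySquare ν.transpose ∧
      μ.transpose.diagDiff ν.transpose = -μ.diagDiff ν := by
  refine h.wlog (motive := fun μ ν => μ.transpose.DifferBySquare ν.transpose ∧
      μ.transpose.diagDiff ν.transpose = -μ.diagDiff ν) (fun μ ν h => ?_) fun μ ν x hx h => ?_
  · exact ⟨h.1.symm, by rw [diagDiff_comm, h.2, diagDiff_comm]⟩
  · have hx' : x.swap ∉ μ.transpose.cells := by simpa using hx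
    have h' : ν.transpose.cells = insert x.swap μ.transpose.cells := by
      ext y
      rw [mem_cells, mem_transpose, ← mem_cells, h, Finset.mem_insert, Finset.mem_insert,
        mem_cells, mem_cells, mem_transpose]
      refine or_congr_left ?_
      rw [Prod.swap_eq_iff_eq_swap]
    refine ⟨⟨_, .inr ⟨hx', h'⟩⟩, ?_⟩
    rw [diagDiff_of_eq_insert hx' h', diagDiff_of_eq_insert hx h]
    simp

end YoungDiagram

/-! ### The partition of a boundary pair with all rows as end points -/

namespace BoundaryPair

variable {a b : ℕ} (B : BoundaryPair a b)

theorem card_β_le (x : ℤ) (h : 0 ≤ x) : ((B.β.filter (· ≤ x)).card : ℤ) ≤ x := by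
  have : B.β.filter (· ≤ x) ⊆ Finset.Icc 1 x := by
    intro y hy
    rw [Finset.mem_filter] at hy
    have := Finset.mem_Icc.1 (B.β_subset hy.1)
    exact Finset.mem_Icc.2 ⟨this.1, hy.2⟩
  have := Finset.card_le_card this
  rw [Int.card_Icc] at this
  omega

theorem filter_β_of_le (x : ℤ) (h : b ≤ x) : B.β.filter (· ≤ x) = B.β :=
  Finset.filter_true_of_mem fun _ hy => ((Finset.mem_Icc.1 (B.β_subset hy)).2).trans h

theorem r_eq (hα : B.α = Finset.Icc 1 (a : ℤ)) : B.r = a := by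
  rw [r, hα]
  simp

theorem card_α_le (hα : B.α = Finset.Icc 1 (a : ℤ)) {i : ℤ} (h0 : 0 ≤ i)
    (hi : i ≤ a) : ((B.α.filter (· ≤ i)).card : ℤ) = i := by
  have : B.α.filter (· ≤ i) = Finset.Icc 1 i := by
    rw [hα]
    ext y
    simp only [Finset.mem_filter, Finset.mem_Icc]
    omega
  rw [this, Int.card_Icc]
  omega

theorem r_le : B.r ≤ b := by
  have := Finset.card_le_card B.β_subset
  rw [Int.card_Icc, ← B.card_eq] at this
  change B.α.card ≤ b
  simpa using this

/-- The number of elements of `β` up to `x`, extended by `x` for negative `x`. -/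
noncomputable def βCount (x : ℤ) : ℤ := if x ≤ 0 then x else (B.β.filter (· ≤ x)).card

theorem βCount_of_nonneg {x : ℤ} (h : 0 ≤ x) : B.βCount x = (B.β.filter (· ≤ x)).card := by
  rw [βCount]
  split_ifs with h'
  · have := B.card_β_le x h
    omega
  · rfl

theorem mem_partition_iff (hα : B.α = Finset.Icc 1 (a : ℤ)) (r s : ℕ) :
    (r, s) ∈ B.partition ↔
      (r < a ∧ s < b) ∧ (((B.β.filter (· ≤ (a : ℤ) + s - r)).card : ℕ) : ℤ) < a - r := by
  rw [partition, YoungDiagram.rectCompl, ← YoungDiagram.mem_cells, Finset.mem_filter,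
    Finset.mem_product, Finset.mem_range, Finset.mem_range]
  refine and_congr_right fun ⟨hr, hs⟩ => ?_
  simp only at hr hs ⊢
  have hra := B.r_eq hα
  have hanti : StrictAnti fun k => ((b : ℤ) - B.βSeq k).toNat := by
    intro k k' hk
    have := B.βSeq_lt hk
    have := B.βSeq_mem k'
    dsimp only
    omega
  set i : Fin B.r := ⟨a - 1 - r, by omega⟩ with hi
  have hβi := B.βSeq_mem i
  have hiv : (i : ℕ) = a - 1 - r := rfl
  have key : (a - 1 - r, b - 1 - s) ∈ YoungDiagram.ofFrobenius
      (fun k => ((b : ℤ) - B.βSeq k).toNat) (fun k => ((a : ℤ) - B.αSeq k).toNat) ↔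
      B.βSeq i ≤ (a : ℤ) + s - r := by
    rw [YoungDiagram.mem_ofFrobenius]
    constructor
    · rintro ⟨k, h | h⟩
      · have := YoungDiagram.strictAnti_add_le hanti (k := i) (m := k) (Fin.le_def.2 h.1)
        have := B.βSeq_mem k
        omega
      · have hlast : a - 1 < B.r := by omega
        have := YoungDiagram.strictAnti_add_le hanti (k := i) (m := ⟨a - 1, hlast⟩)
          (Fin.le_def.2 (by simp only; omega))
        simp only at this
        have := k.2
        omega
    · intro h
      exact ⟨i, .inl ⟨le_rfl, by omega⟩⟩
  rw [key, B.βSeq_le_iff]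
  omega

theorem edge_partition (hα : B.α = Finset.Icc 1 (a : ℤ)) (c : ℤ) :
    B.partition.edge c = a - B.βCount (a + c) := by
  have hcard : (B.β.filter (· ≤ (a : ℤ) + c)).card ≤ B.β.card := Finset.card_filter_le _ _
  have hβ : B.β.card = a := by rw [← B.card_eq]; exact B.r_eq hα
  have hab := B.r_le
  rw [B.r_eq hα] at hab
  have hle : 0 ≤ (a : ℤ) + c → ((B.β.filter (· ≤ (a : ℤ) + c)).card : ℤ) ≤ a + c :=
    B.card_β_le _
  have hfull : (b : ℤ) ≤ a + c → (B.β.filter (· ≤ (a : ℤ) + c)).card = a := fun h => by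
    rw [B.filter_β_of_le _ h, hβ]
  refine YoungDiagram.edge_eq ?_ ?_ fun r s hrs => ?_
  · rw [βCount]; split_ifs <;> omega
  · rw [βCount]; split_ifs <;> omega
  · rw [B.mem_partition_iff hα, show (a : ℤ) + s - r = a + c by omega, βCount]
    split_ifs <;> omega

theorem partition_transpose (B : BoundaryPair a b) (B' : BoundaryPair b a) (h1 : B'.α = B.β)
    (h2 : B'.β = B.α) : B'.partition = B.partition.transpose := by
  obtain ⟨α, β, hα, hβ, hc⟩ := B
  obtain ⟨α', β', hα', hβ', hc'⟩ := B'
  simp only at h1 h2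
  subst h1 h2
  ext ⟨r, s⟩
  rw [YoungDiagram.mem_cells, YoungDiagram.mem_cells, YoungDiagram.mem_transpose]
  simp only [partition, YoungDiagram.rectCompl, ← YoungDiagram.mem_cells, Finset.mem_filter,
    Finset.mem_product, Finset.mem_range, Prod.swap_prod_mk]
  rw [and_comm (a := s < a)]
  refine and_congr_right fun _ => not_congr ?_
  rw [YoungDiagram.mem_cells, YoungDiagram.mem_cells, YoungDiagram.mem_ofFrobenius,
    YoungDiagram.mem_ofFrobenius]
  constructor
  · rintro ⟨k, h⟩
    exact ⟨⟨k, by have := k.2; simp only [BoundaryPair.r] at this ⊢; omega⟩,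
      h.symm.imp And.symm And.symm⟩
  · rintro ⟨k, h⟩
    exact ⟨⟨k, by have := k.2; simp only [BoundaryPair.r] at this ⊢; omega⟩,
      h.symm.imp And.symm And.symm⟩

end BoundaryPair

/-! ### Extended height functions -/

/-- For `α = [a]`, height functions extended to all columns, in such a way that columns outside
of `[b]` contain no diagonal defects. -/
structure IsExtHeight {a b : ℕ} (B : BoundaryPair a b) (E : ℤ → ℤ → ℤ) : Prop where
  top : ∀ j : ℤ, E 0 j = min 0 j
  left : ∀ i j : ℤ, 0 ≤ i → i ≤ a → j ≤ 0 → E i j = j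
  right : ∀ i j : ℤ, 0 ≤ i → i ≤ a → b ≤ j → E i j = i
  bottom : ∀ j : ℤ, E a j = B.βCount j
  row_step : ∀ i j : ℤ, 0 ≤ i → i ≤ a → E i (j - 1) ≤ E i j ∧ E i j ≤ E i (j - 1) + 1
  col_step : ∀ i j : ℤ, 1 ≤ i → i ≤ a → E (i - 1) j ≤ E i j ∧ E i j ≤ E (i - 1) j + 1

section ExtHeight

variable {a b : ℕ} {B : BoundaryPair a b}

theorem IsHeight.exists_ext {C : ℤ → ℤ → ℤ} (hC : IsHeight B C)
    (hα : B.α = Finset.Icc 1 (a : ℤ)) : ∃ E, IsExtHeight B E ∧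
      ∀ i j : ℤ, 0 ≤ i → i ≤ a → 0 ≤ j → j ≤ b → E i j = C i j := by
  have hβ : B.β.card = a := by rw [← B.card_eq]; exact B.r_eq hα
  have hab : a ≤ b := by have := B.r_le; rwa [B.r_eq hα] at this
  have hr : ∀ i : ℤ, 0 ≤ i → i ≤ a → C i b = i := fun i h0 h1 => by
    rw [hC.right i h0 h1, B.card_α_le hα h0 h1]
  set E : ℤ → ℤ → ℤ := fun i j => if j ≤ 0 then j else if b ≤ j then i else C i j with hE
  have hEC : ∀ i j : ℤ, 0 ≤ i → i ≤ a → 0 ≤ j → j ≤ b → E i j = C i j := by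
    intro i j h1 h2 h3 h4
    simp only [hE]
    split_ifs with h5 h6
    · rw [show j = 0 by omega, hC.left i h1 h2]
    · rw [show j = b by omega, hr i h1 h2]
    · rfl
  have hEl : ∀ i j, j ≤ 0 → E i j = j := fun i j h => if_pos h
  have hEr : ∀ i j : ℤ, 0 ≤ i → i ≤ a → b ≤ j → E i j = i := by
    intro i j h0 h1 h2
    simp only [hE]
    split_ifs <;> omega
  refine ⟨E, ⟨fun j => ?_, fun i j _ _ => hEl i j, hEr, fun j => ?_, fun i j h0 h1 => ?_,
    fun i j h0 h1 => ?_⟩, hEC⟩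
  · rcases le_total j 0 with h | h
    · rw [hEl 0 j h, min_eq_right h]
    · rw [min_eq_left h]
      rcases le_total j b with h' | h'
      · rw [hEC 0 j le_rfl (by omega) h h', hC.top j h h']
      · rw [hEr 0 j le_rfl (by omega) h']
  · rcases le_total j 0 with h | h
    · rw [hEl _ j h, BoundaryPair.βCount, if_pos h]
    · rw [B.βCount_of_nonneg h]
      rcases le_total j b with h' | h'
      · rw [hEC _ j (by omega) le_rfl h h', hC.bottom j h h']
      · rw [hEr _ j (by omega) le_rfl h', B.filter_β_of_le j h', hβ]
  · by_cases h : 1 ≤ j ∧ j ≤ b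
    · rw [hEC i j h0 h1 (by omega) h.2, hEC i (j - 1) h0 h1 (by omega) (by omega)]
      exact hC.row_step i j h0 h1 h.1 h.2
    · by_cases h' : j ≤ 0
      · rw [hEl i j h', hEl i (j - 1) (by omega)]
        omega
      · rw [hEr i j h0 h1 (by omega), hEr i (j - 1) h0 h1 (by omega)]
        omega
  · by_cases h : 0 ≤ j ∧ j ≤ b
    · rw [hEC i j (by omega) h1 h.1 h.2, hEC (i - 1) j (by omega) (by omega) h.1 h.2]
      exact hC.col_step i j h0 h1 h.1 h.2
    · by_cases h' : j ≤ 0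
      · rw [hEl i j h', hEl (i - 1) j (by omega)]
        omega
      · rw [hEr i j (by omega) h1 (by omega), hEr (i - 1) j (by omega) (by omega) (by omega)]
        omega

theorem IsExtHeight.isHeight {E : ℤ → ℤ → ℤ} (hE : IsExtHeight B E)
    (hα : B.α = Finset.Icc 1 (a : ℤ)) : IsHeight B E where
  left i h0 h1 := hE.left i 0 h0 h1 le_rfl
  top j h0 _ := by rw [hE.top, min_eq_left h0]
  right i h0 h1 := by rw [hE.right i b h0 h1 le_rfl, B.card_α_le hα h0 h1]
  bottom j h0 _ := by rw [hE.bottom, B.βCount_of_nonneg h0]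
  row_step i j h0 h1 _ _ := hE.row_step i j h0 h1
  col_step i j h0 h1 _ _ := hE.col_step i j h0 h1

theorem IsExtHeight.mem_diagonalDefects {E : ℤ → ℤ → ℤ} (hE : IsExtHeight B E) {i j : ℤ} :
    (i, j) ∈ diagonalDefects a b E ↔ (1 ≤ i ∧ i ≤ a) ∧ E i j ≠ E (i - 1) (j - 1) + 1 := by
  rw [diagonalDefects, Finset.mem_filter, mem_rectangle, and_assoc]
  refine and_congr_right fun hi => ?_
  refine ⟨fun h => h.2, fun h => ⟨?_, h⟩⟩
  by_contra hj
  by_cases h' : j ≤ 0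
  · rw [hE.left i j (by omega) hi.2 h', hE.left _ _ (by omega) (by omega) (by omega)] at h
    omega
  · rw [hE.right i j (by omega) hi.2 (by omega),
      hE.right _ _ (by omega) (by omega) (by omega)] at h
    omega

theorem mem_VOS_iff_ext {l : ℕ} {S : Finset (ℤ × ℤ)} (hα : B.α = Finset.Icc 1 (a : ℤ)) :
    S ∈ VOS B l ↔ S.card = l ∧ ∃ E, IsExtHeight B E ∧
      ∀ i j, (i, j) ∈ S ↔ (1 ≤ i ∧ i ≤ a) ∧ E i j ≠ E (i - 1) (j - 1) + 1 := by
  rw [mem_VOS_iff]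
  refine and_congr_right fun _ => ⟨?_, ?_⟩
  · rintro ⟨C, hC, rfl⟩
    obtain ⟨E, hE, hEC⟩ := hC.exists_ext hα
    refine ⟨E, hE, fun i j => ?_⟩
    rw [← hE.mem_diagonalDefects, diagonalDefects, diagonalDefects, Finset.mem_filter,
      Finset.mem_filter, mem_rectangle]
    refine and_congr_right fun h => ?_
    rw [hEC i j (by omega) (by omega) (by omega) (by omega),
      hEC (i - 1) (j - 1) (by omega) (by omega) (by omega) (by omega)]
  · rintro ⟨E, hE, hS⟩
    refine ⟨E, hE.isHeight hα, ?_⟩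
    ext ⟨i, j⟩
    rw [hS, hE.mem_diagonalDefects]

/-- On a diagonal, `i - E i (i + c)` changes only at diagonal defects. -/
theorem IsExtHeight.diagonal_eq {E : ℤ → ℤ → ℤ} {S : Finset (ℤ × ℤ)}
    (hS : ∀ i j, (i, j) ∈ S ↔ (1 ≤ i ∧ i ≤ a) ∧ E i j ≠ E (i - 1) (j - 1) + 1) {c i i' : ℤ}
    (h0 : 0 ≤ i) (h0' : 0 ≤ i') (hi : i ≤ a) (hi' : i' ≤ a)
    (h : ∀ m, (m, m + c) ∈ S → (m ≤ i ↔ m ≤ i')) : i - E i (i + c) = i' - E i' (i' + c) := by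
  have key : ∀ i i' : ℤ, i ≤ i' → 0 ≤ i → i' ≤ a → (∀ m, (m, m + c) ∈ S → (m ≤ i ↔ m ≤ i')) →
      i - E i (i + c) = i' - E i' (i' + c) := by
    intro i i' hii
    induction i', hii using Int.leInduction with
    | base => intros; rfl
    | succ k hk ih =>
      intro h0 hk' h
      rw [ih h0 (by omega) fun m hm => ?_]
      · have h1 := mt (h (k + 1)) (by omega)
        rw [hS] at h1
        have h2 : E (k + 1) (k + 1 + c) = E (k + 1 - 1) (k + 1 + c - 1) + 1 := by
          by_contra hne
          exact h1 ⟨by omega, hne⟩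
        rw [h2, show k + 1 - 1 = k by omega, show k + 1 + c - 1 = k + c by omega]
        omega
      · have h1 := h m hm
        constructor <;> intro <;> omega
  rcases le_total i i' with hii | hii
  · exact key i i' hii h0 hi' h
  · exact (key i' i hii h0' hi fun m hm => (h m hm).symm).symm

end ExtHeight

/-! ### Orderings of finite sets of points -/

theorem forall_lt_of_consecutive {l : ℕ} {R : Fin l → Fin l → Prop}
    (trans : ∀ x y z, R x y → R y z → R x z)
    (h : ∀ k k' : Fin l, (k' : ℕ) = k + 1 → R k k') {k k' : Fin l} (hk : k < k') : R k k' := by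
  obtain ⟨d, hd⟩ := Nat.exists_eq_add_of_lt (Fin.lt_def.1 hk)
  clear hk
  induction d generalizing k' with
  | zero => exact h _ _ hd
  | succ d ih =>
    have := k'.2
    exact trans _ _ _ (ih (k' := ⟨k + d + 1, by omega⟩) rfl) (h _ _ (by simp only; omega))

theorem lexPair_lt_iff {p q : ℤ × ℤ} :
    lexPair.lt p q ↔ p.1 < q.1 ∨ (p.1 = q.1 ∧ content p < content q) := Iff.rfl

theorem lexPair_lt_iff_toLex {p q : ℤ × ℤ} : lexPair.lt p q ↔ toLex p < toLex q := by
  rw [lexPair_lt_iff, Prod.Lex.toLex_lt_toLex]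
  simp only [content]
  omega

theorem IsInducedOrdering.lt {l : ℕ} {S : Finset (ℤ × ℤ)} {s : Fin l → ℤ × ℤ}
    (h : IsInducedOrdering lexPair S s) {k k' : Fin l} (hk : k < k') :
    (s k).1 < (s k').1 ∨ ((s k).1 = (s k').1 ∧ content (s k) < content (s k')) :=
  forall_lt_of_consecutive (R := fun k k' => lexPair.lt (s k) (s k'))
    (fun x y z h1 h2 => by simp only [lexPair_lt_iff] at *; omega) h.2.2 hk

theorem IsInducedOrdering.strictMono {l : ℕ} {S : Finset (ℤ × ℤ)} {s : Fin l → ℤ × ℤ}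
    (h : IsInducedOrdering lexPair S s) : StrictMono (toLex ∘ s) := fun _ _ hk =>
  lexPair_lt_iff_toLex.1 (h.lt hk)

theorem IsInducedOrdering.unique {l : ℕ} {S : Finset (ℤ × ℤ)} {s s' : Fin l → ℤ × ℤ}
    (h : IsInducedOrdering lexPair S s) (h' : IsInducedOrdering lexPair S s') : s = s' := by
  have hr : Set.range s = Set.range s' := by
    have h1 := congrArg (fun T : Finset (ℤ × ℤ) => (T : Set (ℤ × ℤ))) (h.2.1.trans h'.2.1.symm)
    simpa using h1
  have := (h.strictMono.range_inj h'.strictMono).1 (by rw [Set.range_comp, Set.range_comp, hr])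
  exact (toLex.injective.comp_left) this

theorem exists_isInducedOrdering {l : ℕ} {S : Finset (ℤ × ℤ)} (hS : S.card = l) :
    ∃ s : Fin l → ℤ × ℤ, IsInducedOrdering lexPair S s := by
  have hc : (S.map toLex.toEmbedding).card = l := by rw [Finset.card_map, hS]
  let f := (S.map toLex.toEmbedding).orderEmbOfFin hc
  refine ⟨fun k => ofLex (f k), ofLex.injective.comp f.injective, ?_, fun k k' hk => ?_⟩
  · ext p
    simp only [Finset.mem_image, Finset.mem_univ, true_and]
    have hrange := Finset.range_orderEmbOfFin (S.map toLex.toEmbedding) hc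
    have := Set.ext_iff.1 hrange (toLex p)
    simp only [Set.mem_range, Finset.coe_map, Set.mem_image, Finset.mem_coe,
      Equiv.coe_toEmbedding, EmbeddingLike.apply_eq_iff_eq, exists_eq_right] at this
    rw [← this]
    exact exists_congr fun k => ofLex.injective.eq_iff' (by simp)
  · rw [lexPair_lt_iff_toLex, toLex_ofLex, toLex_ofLex]
    exact f.strictMono (Fin.lt_def.2 (by omega))

/-! ### Oscillating tableaux -/

/-- An oscillating tableau is determined by its profile. -/
theorem IsOscTableau.eq_of_profile_eq {l : ℕ} {η η' : Fin (l + 1) → YoungDiagram}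
    (h : IsOscTableau η) (h' : IsOscTableau η') (hp : ∀ k, profile η k = profile η' k) :
    η = η' := by
  funext k
  induction k using Fin.induction with
  | zero => rw [h.1, h'.1]
  | succ k ih =>
    refine (h.2 k).eq_of_diagDiff_eq ?_ ?_
    · rw [ih]; exact h'.2 k
    · have := hp k
      simp only [profile] at this
      rw [this, ih]

/-- The boundary function changes at `c` only where the profile is `c`. -/
theorem IsOscTableau.edge_eq {l : ℕ} {η : Fin (l + 1) → YoungDiagram} (h : IsOscTableau η)
    {c : ℤ} {m m' : Fin (l + 1)}
    (hm : ∀ k : Fin l, profile η k = c → ((k : ℕ) < m ↔ (k : ℕ) < m')) :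
    (η m).edge c = (η m').edge c := by
  have key : ∀ d : ℕ, ∀ m m' : Fin (l + 1), (m' : ℕ) = m + d →
      (∀ k : Fin l, profile η k = c → ((k : ℕ) < m ↔ (k : ℕ) < m')) →
      (η m).edge c = (η m').edge c := by
    intro d
    induction d with
    | zero =>
      intro m m' hd _
      rw [show m = m' from Fin.ext (by omega)]
    | succ d ih =>
      intro m m' hd hm
      have hlt := m'.2
      have hne : profile η ⟨m + d, by omega⟩ ≠ c := fun hc => by
        have := hm _ hc
        simp only at this
        omega
      have h1 := ((h.2 ⟨m + d, by omega⟩).edge.1 c hne.symm)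
      rw [ih m (Fin.castSucc ⟨m + d, by omega⟩) rfl fun k hk => ?_, ← h1]
      · congr 2
        exact Fin.ext (by simp; omega)
      · have h2 := hm k hk
        have h3 : (k : ℕ) ≠ m + d := fun h3 => hne (by rw [← hk]; congr 1; exact Fin.ext h3.symm)
        simp only [Fin.val_castSucc]
        omega
  rcases le_total (m : ℕ) m' with hle | hle
  · exact key (m' - m) m m' (by omega) hm
  · exact (key (m - m') m' m (by omega) fun k hk => (hm k hk).symm).symm

theorem IsAssociated.unique {l : ℕ} {S : Finset (ℤ × ℤ)}
    {x x' : (Fin l → ℤ) × (Fin (l + 1) → YoungDiagram)} (h : IsAssociated lexPair S x)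
    (h' : IsAssociated lexPair S x') : x = x' := by
  obtain ⟨s, hs, h1, h2, h3⟩ := h
  obtain ⟨s', hs', h1', h2', h3'⟩ := h'
  obtain rfl := hs.unique hs'
  exact Prod.ext (funext fun k => by rw [h1, h1'])
    (h2.eq_of_profile_eq h2' fun k => by rw [h3, h3'])

theorem IsAssociated.lexInverse_eq {l : ℕ} {S : Finset (ℤ × ℤ)}
    {x : (Fin l → ℤ) × (Fin (l + 1) → YoungDiagram)} (h : IsAssociated lexPair S x) :
    lexInverse x = S := by
  obtain ⟨s, hs, h1, h2, h3⟩ := h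
  rw [← hs.2.1, lexInverse]
  refine Finset.image_congr fun k _ => ?_
  simp only [h1, h3, lexPair, content, add_sub_cancel]

theorem IsAssociated.antilexInverse_eq {l : ℕ} {S : Finset (ℤ × ℤ)}
    {x : (Fin l → ℤ) × (Fin (l + 1) → YoungDiagram)} (h : IsAssociated antilexPair S x) :
    antilexInverse x = S := by
  obtain ⟨s, hs, h1, h2, h3⟩ := h
  rw [← hs.2.1, antilexInverse]
  refine Finset.image_congr fun k _ => ?_
  simp only [h1, h3, antilexPair, content, sub_sub_cancel]

/-! ### From height functions to generalized oscillating tableaux -/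

section LexTableaux

variable {a b : ℕ} {B : BoundaryPair a b} {l : ℕ}

/-- The last row of the diagonal of content `c` which has been read after the points
`s₁, …, s_k`, if the rectangle is read row by row. -/
def lastRow (s : Fin l → ℤ × ℤ) (k : Fin (l + 1)) : ℤ → ℤ :=
  Fin.cases (motive := fun _ => ℤ → ℤ) (fun _ => 0)
    (fun m c => if c ≤ content (s m) then (s m).1 else (s m).1 - 1) k

theorem lastRow_zero (s : Fin l → ℤ × ℤ) (c : ℤ) : lastRow s 0 c = 0 := rfl

theorem lastRow_succ (s : Fin l → ℤ × ℤ) (m : Fin l) (c : ℤ) :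
    lastRow s m.succ c = if c ≤ content (s m) then (s m).1 else (s m).1 - 1 := rfl

theorem lastRow_mem {s : Fin l → ℤ × ℤ} (hs : ∀ m, 1 ≤ (s m).1 ∧ (s m).1 ≤ a)
    (k : Fin (l + 1)) (c : ℤ) : 0 ≤ lastRow s k c ∧ lastRow s k c ≤ a := by
  cases k using Fin.cases with
  | zero => rw [lastRow_zero]; omega
  | succ m =>
    rw [lastRow_succ]
    have := hs m
    split_ifs <;> omega

theorem lastRow_step (s : Fin l → ℤ × ℤ) (k : Fin (l + 1)) (c : ℤ) :
    lastRow s k (c + 1) = lastRow s k c ∨ lastRow s k (c + 1) = lastRow s k c - 1 := by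
  cases k using Fin.cases with
  | zero => left; rfl
  | succ m =>
    rw [lastRow_succ, lastRow_succ]
    split_ifs <;> omega

theorem le_lastRow_iff {S : Finset (ℤ × ℤ)} {s : Fin l → ℤ × ℤ}
    (h : IsInducedOrdering lexPair S s) (hs : ∀ m, 1 ≤ (s m).1) (k : Fin (l + 1)) (m : Fin l) :
    (s m).1 ≤ lastRow s k (content (s m)) ↔ (m : ℕ) < k := by
  cases k using Fin.cases with
  | zero =>
    rw [lastRow_zero]
    have := hs m
    simp only [Fin.val_zero]
    omega
  | succ k =>
    rw [lastRow_succ, Fin.val_succ]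
    rcases lt_trichotomy m k with hmk | rfl | hmk
    · have := h.lt hmk
      have := Fin.lt_def.1 hmk
      split_ifs <;> omega
    · rw [if_pos le_rfl]
      omega
    · have := h.lt hmk
      have := Fin.lt_def.1 hmk
      split_ifs <;> omega

/-- After the points `s₁, …, s_k` of the set of defects have been read, the boundary function of
the partition is `i - E i (i + c)`, where row `i` is the last one read on the diagonal of
content `c`. -/
theorem IsExtHeight.exists_associated {E : ℤ → ℤ → ℤ} {S : Finset (ℤ × ℤ)}
    (hE : IsExtHeight B E) (hα : B.α = Finset.Icc 1 (a : ℤ)) (hl : S.card = l)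
    (hS : ∀ i j, (i, j) ∈ S ↔ (1 ≤ i ∧ i ≤ a) ∧ E i j ≠ E (i - 1) (j - 1) + 1) :
    ∃ x ∈ GOT (Set.Icc 1 (a : ℤ)) (fun x y => x < y) B.partition l,
      IsAssociated lexPair S x := by
  obtain ⟨s, hs⟩ := exists_isInducedOrdering hl
  have hsS : ∀ p, p ∈ S ↔ ∃ m, s m = p := by
    intro p
    rw [← hs.2.1]
    simp
  have hrow : ∀ m, 1 ≤ (s m).1 ∧ (s m).1 ≤ a := fun m =>
    ((hS (s m).1 (s m).2).1 ((hsS _).2 ⟨m, rfl⟩)).1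
  -- The boundary function of the `k`-th partition.
  set f : Fin (l + 1) → ℤ → ℤ := fun k c => lastRow s k c - E (lastRow s k c) (lastRow s k c + c)
    with hf
  have hfE : ∀ (k : Fin (l + 1)) (c i : ℤ), 0 ≤ i → i ≤ a →
      (∀ m : Fin l, content (s m) = c → ((m : ℕ) < k ↔ (s m).1 ≤ i)) →
      f k c = i - E i (i + c) := by
    intro k c i h0 h1 h
    have hr := lastRow_mem hrow k c
    refine IsExtHeight.diagonal_eq hS hr.1 h0 hr.2 h1 fun m hm => ?_
    obtain ⟨n, hn⟩ := (hsS _).1 hm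
    have hc : content (s n) = c := by rw [hn]; simp [content]
    have hle := le_lastRow_iff hs (fun m => (hrow m).1) k n
    rw [hc, hn] at hle
    rw [hle, h n hc, hn]
  have hY : ∀ k, ∃ μ : YoungDiagram, ∀ c, μ.edge c = f k c := by
    intro k
    refine YoungDiagram.exists_edge_eq (a + b) (fun c => ?_) (fun c hc => ?_) fun c hc => ?_
    · have hr := lastRow_mem hrow k c
      have hr' := lastRow_mem hrow k (c + 1)
      simp only [hf]
      have hst := lastRow_step s k c
      set i := lastRow s k c
      rcases hst with h | h
      · rw [h]
        have := hE.row_step i (i + (c + 1)) hr.1 hr.2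
        rw [show i + (c + 1) - 1 = i + c by omega] at this
        omega
      · rw [h] at hr' ⊢
        rw [show i - 1 + (c + 1) = i + c by omega]
        have := hE.col_step i (i + c) (by omega) hr.2
        omega
    · have hr := lastRow_mem hrow k c
      simp only [hf]
      rw [hE.right _ _ hr.1 hr.2 (by push_cast at hc; omega)]
      omega
    · have hr := lastRow_mem hrow k c
      simp only [hf]
      rw [hE.left _ _ hr.1 hr.2 (by push_cast at hc; omega)]
      omega
  choose η hη using hY
  have hstep : ∀ k : Fin l, (η k.castSucc).DifferBySquare (η k.succ) ∧
      (η k.castSucc).diagDiff (η k.succ) = content (s k) := by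
    intro k
    have hk := hrow k
    have hkS := ((hS (s k).1 (s k).2).1 ((hsS _).2 ⟨k, rfl⟩)).2
    refine YoungDiagram.differBySquare_of_edge (fun c hc => ?_) ?_
    · rw [hη, hη]
      have hr := lastRow_mem hrow k.castSucc c
      refine hfE _ _ _ hr.1 hr.2 fun m hm => ?_
      rw [← hm, le_lastRow_iff hs (fun m => (hrow m).1)]
      have : (m : ℕ) ≠ k := fun h => hc (by rw [← hm, Fin.ext h])
      simp only [Fin.val_succ, Fin.val_castSucc]
      omega
    · -- On the diagonal of `s_k`, the row read last changes from the previous one to that of `s_k`.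
      have hlt : ∀ m : Fin l, content (s m) = content (s k) →
          ((m : ℕ) < k → (s m).1 < (s k).1) ∧ ((k : ℕ) < m → (s k).1 < (s m).1) := by
        intro m hm
        exact ⟨fun h => (hs.lt (Fin.lt_def.2 h)).resolve_right (by omega),
          fun h => (hs.lt (Fin.lt_def.2 h)).resolve_right (by omega)⟩
      have h1 := hfE k.castSucc (content (s k)) ((s k).1 - 1) (by omega) (by omega) fun m hm => by
        have := hlt m hm
        have h3 : (m : ℕ) = k → (s m).1 = (s k).1 := fun h => by rw [Fin.ext h]
        simp only [Fin.val_castSucc]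
        omega
      have h2 := hfE k.succ (content (s k)) (s k).1 (by omega) (by omega) fun m hm => by
        have := hlt m hm
        have h3 : (m : ℕ) = k → (s m).1 = (s k).1 := fun h => by rw [Fin.ext h]
        simp only [Fin.val_succ]
        omega
      rw [hη, hη, h1, h2]
      have e1 : (s k).1 + content (s k) = (s k).2 := by simp [content]
      have e2 : (s k).1 - 1 + content (s k) = (s k).2 - 1 := by simp only [content]; ring
      rw [e1, e2]
      have c1 := hE.row_step (s k).1 (s k).2 (by omega) hk.2
      have c2 := hE.col_step (s k).1 ((s k).2 - 1) hk.1 hk.2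
      omega
  have hosc : IsOscTableau η := by
    refine ⟨YoungDiagram.edge_injective fun c => ?_, fun k => (hstep k).1⟩
    rw [hη, YoungDiagram.edge_bot, hfE 0 c 0 le_rfl (by omega) fun m _ => ?_]
    · rw [hE.top]
      omega
    · have := hrow m
      simp only [Fin.val_zero]
      omega
  have hlast : η (Fin.last l) = B.partition := by
    refine YoungDiagram.edge_injective fun c => ?_
    rw [hη, B.edge_partition hα, hfE _ c a (by omega) le_rfl fun m _ => ?_, hE.bottom]
    have := hrow m
    have := m.2
    simp only [Fin.val_last]
    omega
  refine ⟨(fun k => (s k).1, η), ⟨fun k => hrow k, ⟨hosc, hlast⟩, fun k k' hk => ?_⟩,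
    s, hs, fun k => rfl, hosc, fun k => (hstep k).2⟩
  have := hs.2.2 k k' hk
  simp only [profile]
  rw [(hstep k).2, (hstep k').2]
  exact this

/-! ### From generalized oscillating tableaux to height functions -/

variable {x : (Fin l → ℤ) × (Fin (l + 1) → YoungDiagram)}

theorem GOT.lt {T : Set ℤ} {μ : YoungDiagram} (hx : x ∈ GOT T (fun x y => x < y) μ l)
    {k k' : Fin l} (hk : k < k') :
    x.1 k < x.1 k' ∨ (x.1 k = x.1 k' ∧ profile x.2 k < profile x.2 k') :=
  forall_lt_of_consecutive
    (R := fun k k' => x.1 k < x.1 k' ∨ (x.1 k = x.1 k' ∧ profile x.2 k < profile x.2 k'))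
    (fun x y z h1 h2 => by omega) hx.2.2 hk

theorem GOT.isInducedOrdering {T : Set ℤ} {μ : YoungDiagram}
    (hx : x ∈ GOT T (fun x y => x < y) μ l) :
    IsInducedOrdering lexPair (lexInverse x) fun k => (x.1 k, x.1 k + profile x.2 k) := by
  refine ⟨fun k k' h => ?_, rfl, fun k k' hk => ?_⟩
  · rw [Prod.mk.injEq] at h
    rcases lt_trichotomy k k' with hk | hk | hk
    · have := GOT.lt hx hk; omega
    · exact hk
    · have := GOT.lt hx hk; omega
  · have := hx.2.2 k k' hk
    rw [lexPair_lt_iff]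
    simp only [content]
    omega

theorem GOT.isAssociated {T : Set ℤ} {μ : YoungDiagram}
    (hx : x ∈ GOT T (fun x y => x < y) μ l) : IsAssociated lexPair (lexInverse x) x :=
  ⟨_, GOT.isInducedOrdering hx, fun _ => rfl, hx.2.1.1, fun k => by simp [content]⟩

theorem GOT.card_lexInverse {T : Set ℤ} {μ : YoungDiagram}
    (hx : x ∈ GOT T (fun x y => x < y) μ l) : (lexInverse x).card = l := by
  have h := GOT.isInducedOrdering hx
  rw [← h.2.1, Finset.card_image_of_injective _ h.1, Finset.card_univ, Fintype.card_fin]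

/-- Initial segments of `Fin l` are given by their lengths. -/
theorem exists_cut {p : Fin l → Prop} (hp : ∀ k k' : Fin l, k ≤ k' → p k' → p k) :
    ∃ m : Fin (l + 1), ∀ k : Fin l, (k : ℕ) < m ↔ p k := by
  classical
  refine ⟨⟨(Finset.univ.filter p).card, ?_⟩, fun k => lt_card_filter_iff hp k⟩
  have := Finset.card_filter_le Finset.univ p
  rw [Finset.card_univ, Fintype.card_fin] at this
  omega

/-- The height function is `i - edge (j - i)`, where `edge` is the boundary function of the
partition reached after the entries at most `i`. Its horizontal steps are steps of this boundary
function, its vertical ones are steps of the boundary function of the partition reached in the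
middle of a row. -/
theorem GOT.exists_ext (hx : x ∈ GOT (Set.Icc 1 (a : ℤ)) (fun x y => x < y) B.partition l)
    (hα : B.α = Finset.Icc 1 (a : ℤ)) : ∃ E, IsExtHeight B E ∧
      ∀ i j, (i, j) ∈ lexInverse x ↔ (1 ≤ i ∧ i ≤ a) ∧ E i j ≠ E (i - 1) (j - 1) + 1 := by
  have hlt := fun k k' (hk : k < k') => GOT.lt hx hk
  obtain ⟨t, η⟩ := x
  obtain ⟨hT, ⟨hosc, hlast⟩, -⟩ := hx
  simp only at hlt hT hosc hlast
  have hT' : ∀ k, 1 ≤ t k ∧ t k ≤ a := hT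
  have hle : ∀ k k', k ≤ k' → k = k' ∨
      (t k < t k' ∨ (t k = t k' ∧ profile η k < profile η k')) :=
    fun k k' hk => hk.eq_or_lt.imp_right (hlt k k')
  have hcut : ∀ i c : ℤ, ∃ m : Fin (l + 1), ∀ k : Fin l,
      (k : ℕ) < m ↔ (t k < i ∨ (t k = i ∧ profile η k ≤ c)) := by
    refine fun i c => exists_cut fun k k' hk h => ?_
    rcases hle k k' hk with rfl | h'
    · exact h
    · omega
  choose mid hmid using hcut
  have hcut : ∀ i : ℤ, ∃ m : Fin (l + 1), ∀ k : Fin l, (k : ℕ) < m ↔ t k ≤ i := by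
    refine fun i => exists_cut fun k k' hk h => ?_
    rcases hle k k' hk with rfl | h'
    · exact h
    · omega
  choose row hrow using hcut
  set E : ℤ → ℤ → ℤ := fun i j => i - (η (row i)).edge (j - i) with hE
  have htop : ∀ j, E 0 j = min 0 j := by
    intro j
    simp only [hE]
    rw [hosc.edge_eq (m' := 0) fun k _ => ?_, hosc.1, YoungDiagram.edge_bot]
    · omega
    · rw [hrow]
      have := hT' k
      simp only [Fin.val_zero]
      omega
  have hbottom : ∀ j, E a j = B.βCount j := by
    intro j
    simp only [hE]
    rw [hosc.edge_eq (m' := Fin.last l) fun k _ => ?_, hlast, B.edge_partition hα,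
      add_sub_cancel, sub_sub_cancel]
    rw [hrow]
    have := hT' k
    have := k.2
    simp only [Fin.val_last]
    omega
  have hrs : ∀ i j, E i (j - 1) ≤ E i j ∧ E i j ≤ E i (j - 1) + 1 := by
    intro i j
    simp only [hE]
    have := (η (row i)).edge_step (j - 1 - i)
    rw [show j - 1 - i + 1 = j - i by omega] at this
    omega
  have hcs : ∀ i j, E (i - 1) j ≤ E i j ∧ E i j ≤ E (i - 1) j + 1 := by
    intro i j
    simp only [hE]
    have h1 : (η (row i)).edge (j - i) = (η (mid i (j - i))).edge (j - i) :=
      hosc.edge_eq fun k hk => by rw [hrow, hmid]; omega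
    have h2 : (η (row (i - 1))).edge (j - i + 1) = (η (mid i (j - i))).edge (j - i + 1) :=
      hosc.edge_eq fun k hk => by rw [hrow, hmid]; omega
    have := (η (mid i (j - i))).edge_step (j - i)
    rw [show j - (i - 1) = j - i + 1 by omega, h1, h2]
    omega
  have hup : ∀ i j, E i j ≤ i ∧ E i j ≤ j := by
    intro i j
    simp only [hE]
    have := (η (row i)).le_edge (j - i)
    omega
  -- Starting from row `0`, monotonicity along columns fixes the values in the columns `j ≤ 0`.
  have hleft : ∀ i j : ℤ, 0 ≤ i → j ≤ 0 → E i j = j := by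
    intro i j hi hj
    induction i, hi using Int.leInduction with
    | base => rw [htop, min_eq_right hj]
    | succ i hi ih =>
      have h1 := (hcs (i + 1) j).1
      rw [add_sub_cancel_right, ih] at h1
      exact le_antisymm (hup _ _).2 h1
  -- Starting from row `a`, the bound on the steps along columns fixes those for `j ≥ b`.
  have hright : ∀ i j : ℤ, i ≤ a → b ≤ j → E i j = i := by
    intro i j hi hj
    induction i, hi using Int.leInductionDown with
    | base =>
      rw [hbottom, B.βCount_of_nonneg (by omega), B.filter_β_of_le j hj, ← B.card_eq]
      exact_mod_cast B.r_eq hα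
    | pred i hi ih =>
      have h1 := (hcs i j).2
      rw [ih] at h1
      have := (hup (i - 1) j).1
      omega
  refine ⟨E, ⟨htop, fun i j h0 _ hj => hleft i j h0 hj, fun i j _ h1 hj => hright i j h1 hj,
    hbottom, fun i j _ _ => hrs i j, fun i j _ _ => hcs i j⟩, fun i j => ?_⟩
  have hmem : (i, j) ∈ lexInverse (t, η) ↔ ∃ k, t k = i ∧ profile η k = j - i := by
    simp only [lexInverse, Finset.mem_image, Finset.mem_univ, true_and, Prod.mk.injEq]
    exact exists_congr fun k => by omega
  rw [hmem]
  simp only [hE]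
  rw [show j - 1 - (i - 1) = j - i by omega]
  constructor
  · rintro ⟨k, rfl, hk⟩
    refine ⟨hT' k, ?_⟩
    have hord : ∀ m : Fin l, profile η m = j - t k →
        ((m : ℕ) < k → t m < t k) ∧ ((k : ℕ) < m → t k < t m) := fun m hm =>
      ⟨fun h => (hlt _ _ (Fin.lt_def.2 h)).resolve_right (by omega),
        fun h => (hlt _ _ (Fin.lt_def.2 h)).resolve_right (by omega)⟩
    have h1 : (η (row (t k - 1))).edge (j - t k) = (η k.castSucc).edge (j - t k) :=
      hosc.edge_eq fun m hm => by
        have := hord m hm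
        have h3 : (m : ℕ) = k → t m = t k := fun h => by rw [Fin.ext h]
        rw [hrow]
        simp only [Fin.val_castSucc]
        omega
    have h2 : (η (row (t k))).edge (j - t k) = (η k.succ).edge (j - t k) :=
      hosc.edge_eq fun m hm => by
        have := hord m hm
        have h3 : (m : ℕ) = k → t m = t k := fun h => by rw [Fin.ext h]
        rw [hrow]
        simp only [Fin.val_succ]
        omega
    have h3 := (hosc.2 k).edge.2
    simp only [profile] at hk
    rw [hk] at h3
    rw [h1, h2]
    omega
  · rintro ⟨hi, hne⟩
    by_contra hno
    refine hne ?_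
    rw [hosc.edge_eq (m' := row (i - 1)) fun k hk => ?_]
    · omega
    · rw [hrow, hrow]
      have : t k ≠ i := fun h => hno ⟨k, h, hk⟩
      omega

end LexTableaux

/-! ### Transposition -/

namespace BoundaryPair

variable {a b : ℕ}

/-- The boundary pair with the two point sets interchanged. -/
def swap (B : BoundaryPair a b) : BoundaryPair b a :=
  ⟨B.β, B.α, B.β_subset, B.α_subset, B.card_eq.symm⟩

end BoundaryPair

section Transposition

variable {a b : ℕ} {B : BoundaryPair a b} {l : ℕ}

theorem IsHeight.swap {C : ℤ → ℤ → ℤ} (hC : IsHeight B C) :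
    IsHeight B.swap fun i j => C j i where
  left i h0 h1 := hC.top i h0 h1
  top j h0 h1 := hC.left j h0 h1
  right i h0 h1 := hC.bottom i h0 h1
  bottom j h0 h1 := hC.right j h0 h1
  row_step i j h1 h2 h3 h4 := hC.col_step j i h3 h4 h1 h2
  col_step i j h1 h2 h3 h4 := hC.row_step j i h3 h4 h1 h2

theorem image_swap_mem_VOS {S : Finset (ℤ × ℤ)} (h : S ∈ VOS B l) :
    S.image Prod.swap ∈ VOS B.swap l := by
  rw [mem_VOS_iff] at h ⊢
  obtain ⟨hl, C, hC, rfl⟩ := h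
  refine ⟨by rw [Finset.card_image_of_injective _ Prod.swap_injective, hl], _, hC.swap, ?_⟩
  ext ⟨i, j⟩
  rw [show (i, j) = Prod.swap (j, i) from rfl, Prod.swap_injective.mem_finset_image,
    Prod.swap_prod_mk, diagonalDefects, diagonalDefects, Finset.mem_filter, Finset.mem_filter,
    mem_rectangle, mem_rectangle, and_comm (a := 1 ≤ j ∧ j ≤ (a : ℤ))]

theorem image_swap_swap (S : Finset (ℤ × ℤ)) : (S.image Prod.swap).image Prod.swap = S := by
  rw [Finset.image_image, Prod.swap_swap_eq, Finset.image_id]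

/-- Transposition of all partitions of an oscillating tableau. -/
def transposeTableau (x : (Fin l → ℤ) × (Fin (l + 1) → YoungDiagram)) :
    (Fin l → ℤ) × (Fin (l + 1) → YoungDiagram) :=
  (x.1, fun k => (x.2 k).transpose)

theorem transposeTableau_transposeTableau (x : (Fin l → ℤ) × (Fin (l + 1) → YoungDiagram)) :
    transposeTableau (transposeTableau x) = x := by
  simp [transposeTableau]

theorem IsOscTableau.transposeTableau {x : (Fin l → ℤ) × (Fin (l + 1) → YoungDiagram)}
    (h : IsOscTableau x.2) : IsOscTableau (transposeTableau x).2 ∧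
      ∀ k, profile (_root_.transposeTableau x).2 k = -profile x.2 k := by
  refine ⟨⟨?_, fun k => (h.2 k).transpose.1⟩, fun k => (h.2 k).transpose.2⟩
  change (x.2 0).transpose = ⊥
  rw [h.1]
  ext ⟨i, j⟩
  simp

theorem transposeTableau_mem_GOT {T : Set ℤ} {prec prec' : ℤ → ℤ → Prop} {μ : YoungDiagram}
    {x : (Fin l → ℤ) × (Fin (l + 1) → YoungDiagram)}
    (hprec : ∀ y z, prec y z → prec' (-y) (-z)) (hx : x ∈ GOT T prec μ l) :
    transposeTableau x ∈ GOT T prec' μ.transpose l := by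
  obtain ⟨h1, ⟨h2, h3⟩, h4⟩ := hx
  obtain ⟨h5, h6⟩ := h2.transposeTableau
  refine ⟨h1, ⟨h5, congrArg YoungDiagram.transpose h3⟩, fun k k' hk => ?_⟩
  rw [h6, h6]
  exact (h4 k k' hk).imp_right fun h => ⟨h.1, hprec _ _ h.2⟩

theorem IsAssociated.transpose {O O' : OrderingPair} (hlevel : ∀ p, O.level p = O'.level p.swap)
    (hprec : ∀ y z, O.prec y z → O'.prec (-y) (-z)) {S : Finset (ℤ × ℤ)}
    {x : (Fin l → ℤ) × (Fin (l + 1) → YoungDiagram)} (h : IsAssociated O S x) :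
    IsAssociated O' (S.image Prod.swap) (transposeTableau x) := by
  obtain ⟨s, ⟨h1, h2, h3⟩, h4, h5, h6⟩ := h
  obtain ⟨h7, h8⟩ := h5.transposeTableau
  have hcont : ∀ p : ℤ × ℤ, content p.swap = -content p := fun p => by simp [content]
  refine ⟨fun k => (s k).swap, ⟨Prod.swap_injective.comp h1, ?_, fun k k' hk => ?_⟩, fun k => ?_,
    h7, fun k => ?_⟩
  · rw [← h2, Finset.image_image]
    rfl
  · have := h3 k k' hk
    simp only [OrderingPair.lt, hlevel] at this
    simp only [OrderingPair.lt, hcont]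
    exact this.imp_right fun h => ⟨h.1, hprec _ _ h.2⟩
  · rw [← hlevel, ← h4]
    rfl
  · rw [h8, hcont, h6]

theorem lexToAntilex {S : Finset (ℤ × ℤ)} {x : (Fin l → ℤ) × (Fin (l + 1) → YoungDiagram)}
    (h : IsAssociated lexPair S x) :
    IsAssociated antilexPair (S.image Prod.swap) (transposeTableau x) :=
  h.transpose (fun _ => rfl) fun y z (h : y < z) => neg_lt_neg h

theorem antilexToLex {S : Finset (ℤ × ℤ)} {x : (Fin l → ℤ) × (Fin (l + 1) → YoungDiagram)}
    (h : IsAssociated antilexPair S x) :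
    IsAssociated lexPair (S.image Prod.swap) (transposeTableau x) :=
  h.transpose (fun _ => rfl) fun y z (h : z < y) => neg_lt_neg h

end Transposition

/-! ### Bijectivity -/

/-- A mapping `inv` which recovers `S` from each pair associated with it, and which takes the pairs
in `G` to sets in `V` with which they are associated, is inverse to the induced mapping. -/
theorem induced_bijection {O : OrderingPair} {l : ℕ} {V : Set (Finset (ℤ × ℤ))}
    {G : Set ((Fin l → ℤ) × (Fin (l + 1) → YoungDiagram))}
    {inv : (Fin l → ℤ) × (Fin (l + 1) → YoungDiagram) → Finset (ℤ × ℤ)}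
    (hex : ∀ S ∈ V, ∃ x ∈ G, IsAssociated O S x)
    (huniq : ∀ S (x x' : (Fin l → ℤ) × (Fin (l + 1) → YoungDiagram)),
      IsAssociated O S x → IsAssociated O S x' → x = x')
    (hinv : ∀ S x, IsAssociated O S x → inv x = S)
    (hG : ∀ x ∈ G, inv x ∈ V ∧ IsAssociated O (inv x) x) :
    (∀ S ∈ V, ∃! x : (Fin l → ℤ) × (Fin (l + 1) → YoungDiagram), IsAssociated O S x) ∧
      Set.BijOn (inducedMap O l) V G ∧ Set.InvOn inv (inducedMap O l) V G := by
  have hmap : ∀ S x, IsAssociated O S x → inducedMap O l S = x := fun S x h =>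
    huniq S _ _ (Classical.epsilon_spec ⟨x, h⟩) h
  have hInv : Set.InvOn inv (inducedMap O l) V G := by
    refine ⟨fun S hS => ?_, fun x hx => hmap _ _ (hG x hx).2⟩
    obtain ⟨x, -, h⟩ := hex S hS
    rw [hmap S x h, hinv S x h]
  refine ⟨fun S hS => ?_, hInv.bijOn (fun S hS => ?_) fun x hx => (hG x hx).1, hInv⟩
  · obtain ⟨x, -, h⟩ := hex S hS
    exact ⟨x, h, fun y hy => huniq S y x hy h⟩
  · obtain ⟨x, hx, h⟩ := hex S hS
    rwa [hmap S x h]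

theorem lex_exists {a b : ℕ} {B : BoundaryPair a b} {l : ℕ} (hα : B.α = Finset.Icc 1 (a : ℤ))
    {S : Finset (ℤ × ℤ)} (hS : S ∈ VOS B l) :
    ∃ x ∈ GOT (Set.Icc 1 (a : ℤ)) (fun x y => x < y) B.partition l,
      IsAssociated lexPair S x := by
  obtain ⟨hl, E, hE, h⟩ := (mem_VOS_iff_ext hα).1 hS
  exact hE.exists_associated hα hl h

theorem lexInverse_mem_VOS {a b : ℕ} {B : BoundaryPair a b} {l : ℕ}
    (hα : B.α = Finset.Icc 1 (a : ℤ)) {x : (Fin l → ℤ) × (Fin (l + 1) → YoungDiagram)}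
    (hx : x ∈ GOT (Set.Icc 1 (a : ℤ)) (fun x y => x < y) B.partition l) :
    lexInverse x ∈ VOS B l :=
  (mem_VOS_iff_ext hα).2 ⟨GOT.card_lexInverse hx, GOT.exists_ext hx hα⟩

theorem theorem16 (a b : ℕ) (ha : 0 < a) (hb : 0 < b) (B : BoundaryPair a b) (l : ℕ) :
    (B.α = Finset.Icc 1 (a : ℤ) →
      (∀ S ∈ VOS B l, ∃! x : (Fin l → ℤ) × (Fin (l + 1) → YoungDiagram),
        IsAssociated lexPair S x) ∧
      Set.BijOn (inducedMap lexPair l) (VOS B l)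
        (GOT (Set.Icc 1 (a : ℤ)) (fun x y => x < y) B.partition l) ∧
      Set.InvOn lexInverse (inducedMap lexPair l) (VOS B l)
        (GOT (Set.Icc 1 (a : ℤ)) (fun x y => x < y) B.partition l)) ∧
    (B.β = Finset.Icc 1 (b : ℤ) →
      (∀ S ∈ VOS B l, ∃! x : (Fin l → ℤ) × (Fin (l + 1) → YoungDiagram),
        IsAssociated antilexPair S x) ∧
      Set.BijOn (inducedMap antilexPair l) (VOS B l)
        (GOT (Set.Icc 1 (b : ℤ)) (fun x y => x > y) B.partition l) ∧
      Set.InvOn antilexInverse (inducedMap antilexPair l) (VOS B l)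
        (GOT (Set.Icc 1 (b : ℤ)) (fun x y => x > y) B.partition l)) := by
  refine ⟨fun hα => induced_bijection (fun S hS => lex_exists hα hS)
      (fun S x x' h h' => h.unique h') (fun S x h => h.lexInverse_eq)
      fun x hx => ⟨lexInverse_mem_VOS hα hx, GOT.isAssociated hx⟩,
    fun hβ => induced_bijection (fun S hS => ?_) (fun S x x' h h' => ?_)
      (fun S x h => h.antilexInverse_eq) fun x hx => ?_⟩
  · obtain ⟨x, hx, h⟩ := lex_exists (B := B.swap) hβ (image_swap_mem_VOS hS)
    refine ⟨transposeTableau x, ?_, by simpa only [image_swap_swap] using lexToAntilex h⟩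
    rw [BoundaryPair.partition_transpose B.swap B rfl rfl]
    exact transposeTableau_mem_GOT (fun y z h => neg_lt_neg h) hx
  · have := (antilexToLex h).unique (antilexToLex h')
    rw [← transposeTableau_transposeTableau x, this, transposeTableau_transposeTableau]
  · have hx' : transposeTableau x ∈
        GOT (Set.Icc 1 (b : ℤ)) (fun x y => x < y) B.swap.partition l := by
      rw [BoundaryPair.partition_transpose B B.swap rfl rfl]
      exact transposeTableau_mem_GOT (fun y z h => neg_lt_neg h) hx
    have h := lexToAntilex (GOT.isAssociated hx')
    rw [transposeTableau_transposeTableau] at h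
    rw [h.antilexInverse_eq]
    exact ⟨image_swap_mem_VOS (lexInverse_mem_VOS (B := B.swap) hβ hx'), h⟩
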